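/- Let $\{0,1\}^{**}$ be the set of pairs $(x,y)$ of bit strings of equal length. A language is a set $L\subseteq\{0,1\}^{**}$; its $n$-bit section $L_n$ is regarded as a Boolean function (Boolean $2^n\times 2^n$ matrix). Logarithms are to base $2$; a function $f(n)$, $n\ge 1$, is $\mathrm{polylog}(n)$ if it is bounded above by a polynomial in $\log n$. A guess protocol $\Pi=(\Pi_1,\dots,\Pi_l)$, $l\ge 1$, is a finite sequence of deterministic two-party protocols with Boolean output. It computes $f$ in PP mode if $f(x,y)=1$ exactly when more of the $\Pi_i$ accept $(x,y)$ than reject it, and it has cost $\lceil\log l\rceil+\max_i D(\Pi_i)$, where $D$ is the worst-case communication. $\mathrm{PP}(f)$ is the least cost of a guess protocol that computes $f$ in PP mode, and $\mathrm{PP}^{cc}=\{L\mid \mathrm{PP}(L_n)=\mathrm{polylog}(n)\}$. For a class $\mathcal C$ of languages, $L\in\mathrm{BP}\cdot\mathcal C$ iff there are $L'\in\mathcal C$ and a polynomially bounded $q:[0,\infty)\to[0,\infty)$ such that for all $n\ge1$ and all $n$-bit pairs $(x,y)$, with $m=\lceil q(\log n)\rceil$, the fraction of the strings $r\in\{0,1\}^m$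 with $(\langle x,r\rangle,\langle y,r\rangle)\in L'$ is at least $2/3$ if $(x,y)\in L$ and at most $1/3$ if $(x,y)\notin L$. Here $\langle x,r\rangle=1^{|x|}0xr$. The margin complexity $\mathrm{mc}(A)$ of a sign matrix $A$ is the infimum of the numbers $1/\gamma$, $\gamma>0$, for which there are unit vectors $u_i,v_j$ in some $\mathbb R^d$ with $A_{ij}\langle u_i,v_j\rangle\ge\gamma$ for all $i,j$. For a Boolean matrix $B$ put $\mathrm{mc}'(B)=\mathrm{mc}(J-2B)$, where $J$ is the all-ones matrix, and $$(\mathrm{BP}\cdot\mathrm{mc}')(B)=\max_{\mu}\ \min_{\tilde B:\ \mu(B\ne\tilde B)\le 1/3}\mathrm{mc}'(\tilde B),$$ where $\mu$ ranges over all probability distributions on the matrix entries and $\tilde B$ over Boolean matrices. Let $$\mathcal M^{cc}=\{L\mid \log\,(\mathrm{BP}\cdot\mathrm{mc}')(L_n)=\mathrm{polylog}(n)\}.$$ $\mathrm{PSPACE}^{cc}$ is the class of languages $L$ for which there are numbers $k=k(n)$ and $l_1(n),\dots,l_k(n)\ge 0$ with $k(n)$ and $l_1(n)+\dots+l_k(n)$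 both $\mathrm{polylog}(n)$, and Boolean functions $\varphi_n,\psi_n$, such that for all $n\ge 1$ and all $n$-bit pairs $(x,y)$: $(x,y)\in L$ iff $\exists u_1\forall u_2\exists u_3\cdots Q_ku_k\;\bigl(\varphi_n(x,u)\diamond\psi_n(y,u)\bigr)$, where $u_i$ ranges over $\{0,1\}^{l_i(n)}$, $u=u_1\cdots u_k$, and $\diamond$ is $\vee$ if $k$ is even and $\wedge$ if $k$ is odd. Then $\mathcal M^{cc}=\mathrm{BP}\cdot\mathrm{PP}^{cc}$. Moreover $\mathrm{BP}\cdot\mathrm{PP}^{cc}\subseteq\mathrm{PSPACE}^{cc}$; hence it is false that $\mathrm{PSPACE}^{cc}\subsetneq\mathcal M^{cc}$. -/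

import Mathlib

namespace CommCC

/-- Bit strings of length `n`. -/
abbrev Word (n : ℕ) : Type := Fin n → Bool

/-- The set of pairs of bit strings of equal length. -/
abbrev WordPair : Type := (n : ℕ) × (Word n × Word n)

/-- A (formal) language: a set of pairs of bit strings of equal length. -/
abbrev CommLanguage : Type := Set WordPair

/-- The `n`-bit section of a language, as a Boolean function (Boolean matrix). -/
noncomputable def nSection (L : CommLanguage) (n : ℕ) (x y : Word n) : Bool :=
  open Classical in decide ((⟨n, x, y⟩ : WordPair) ∈ L)

/-- `f n = polylog(n)`: bounded by a polynomial in `log n`, for all `n ≥ 1`. -/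
def IsPolylog (f : ℕ → ℝ) : Prop :=
  ∃ p : Polynomial ℝ, ∀ n : ℕ, 1 ≤ n → f n ≤ p.eval (Real.logb 2 n)

/-! ### Deterministic protocols, guess protocols and PP -/

/-- Deterministic two-party protocols (protocol trees): at an inner node one of the players sends
a bit that depends on that player's input (`false` leads to the first subtree, `true` to the
second one); a leaf is labelled with the output. -/
inductive Protocol (X Y : Type) : Type
  | leaf (b : Bool) : Protocol X Y
  | alice (a : X → Bool) (l r : Protocol X Y) : Protocol X Y
  | bob (b : Y → Bool) (l r : Protocol X Y) : Protocol X Y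

/-- The function computed by a deterministic protocol. -/
def Protocol.eval {X Y : Type} : Protocol X Y → X → Y → Bool
  | .leaf b, _, _ => b
  | .alice a l r, x, y => if a x then r.eval x y else l.eval x y
  | .bob b l r, x, y => if b y then r.eval x y else l.eval x y

/-- The worst-case communication cost: the height of the protocol tree. -/
def Protocol.cost {X Y : Type} : Protocol X Y → ℕ
  | .leaf _ => 0
  | .alice _ l r => max l.cost r.cost + 1
  | .bob _ l r => max l.cost r.cost + 1

/-- A guess protocol: a finite nonempty sequence of deterministic protocols. -/
structure GuessProtocol (X Y : Type) : Type where
  numGuesses : ℕ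
  numGuesses_pos : 0 < numGuesses
  protocol : Fin numGuesses → Protocol X Y

namespace GuessProtocol

variable {X Y : Type}

/-- The number of accepting guesses. -/
def acc (P : GuessProtocol X Y) (x : X) (y : Y) : ℕ :=
  (Finset.univ.filter fun i => (P.protocol i).eval x y = true).card

/-- The number of rejecting guesses. -/
def rej (P : GuessProtocol X Y) (x : X) (y : Y) : ℕ :=
  (Finset.univ.filter fun i => (P.protocol i).eval x y = false).card

/-- `P` computes `f` in PP acceptance mode. -/
def ComputesPP (P : GuessProtocol X Y) (f : X → Y → Bool) : Prop :=
  ∀ x y, f x y = true ↔ P.rej x y < P.acc x y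

/-- The worst-case communication cost `⌈log l⌉ + max_i D(Π_i)`. -/
def cost (P : GuessProtocol X Y) : ℕ :=
  Nat.clog 2 P.numGuesses + Finset.univ.sup fun i => (P.protocol i).cost

end GuessProtocol

/-- The PP communication complexity of a Boolean function. -/
noncomputable def ppComplexity {X Y : Type} (f : X → Y → Bool) : ℕ :=
  sInf {c : ℕ | ∃ P : GuessProtocol X Y, P.ComputesPP f ∧ P.cost = c}

/-- The class `PP^cc`. -/
def PPcc : Set CommLanguage :=
  {L | IsPolylog fun n => (ppComplexity (nSection L n) : ℝ)}

/-! ### The BP-operator on classes -/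

/-- The pairing `⟨x, r⟩ = 1ⁿ 0 x r` of bit strings, with `n = |x|`. -/
def pair {n m : ℕ} (x : Word n) (r : Word m) : Word (n + (1 + (n + m))) :=
  Fin.append (fun _ => true) (Fin.append (fun _ => false) (Fin.append x r))

/-- The fraction of the strings `r` of length `m` with `(⟨x, r⟩, ⟨y, r⟩) ∈ L'`. -/
noncomputable def acceptFraction (L' : CommLanguage) {n : ℕ} (m : ℕ) (x y : Word n) : ℝ :=
  (Set.ncard {r : Word m | (⟨_, pair x r, pair y r⟩ : WordPair) ∈ L'} : ℝ) / 2 ^ m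

/-- `q` is nonnegative and polynomially bounded on the nonnegative reals. -/
def PolyBounded (q : ℝ → ℝ) : Prop :=
  ∃ p : Polynomial ℝ, ∀ t : ℝ, 0 ≤ t → 0 ≤ q t ∧ q t ≤ p.eval t

/-- The class `BP·C`. -/
def BPop (C : Set CommLanguage) : Set CommLanguage :=
  {L | ∃ L' ∈ C, ∃ q : ℝ → ℝ, PolyBounded q ∧
    ∀ n : ℕ, 1 ≤ n → ∀ x y : Word n,
      ((⟨n, x, y⟩ : WordPair) ∉ L → acceptFraction L' ⌈q (Real.logb 2 n)⌉₊ x y ≤ 1 / 3) ∧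
      ((⟨n, x, y⟩ : WordPair) ∈ L → 2 / 3 ≤ acceptFraction L' ⌈q (Real.logb 2 n)⌉₊ x y)}

/-! ### Margin complexity and its BP-perturbation -/

/-- The margin complexity of a sign matrix `A`: the infimum of the reciprocals of the margins
of the realizations of `A` by unit vectors in a finite-dimensional Euclidean space. -/
noncomputable def marginComplexity {X Y : Type} (A : Matrix X Y ℝ) : ℝ :=
  sInf {m : ℝ | 0 < m ∧ ∃ (d : ℕ) (u : X → EuclideanSpace ℝ (Fin d))
    (v : Y → EuclideanSpace ℝ (Fin d)),
    (∀ i, ‖u i‖ = 1) ∧ (∀ j, ‖v j‖ = 1) ∧ ∀ i j, 1 / m ≤ A i j * inner ℝ (u i) (v j)}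

/-- `mc'(B) = mc(J - 2B)` for a Boolean matrix `B`. -/
noncomputable def mcBool {X Y : Type} (B : X → Y → Bool) : ℝ :=
  marginComplexity (Matrix.of fun x y => 1 - 2 * (if B x y then (1 : ℝ) else 0))

/-- The perturbation `(BP_ε · Λ)(f) = max_μ min_{g : μ(f ≠ g) ≤ ε} Λ(g)` of a measure `Λ` of
Boolean matrices, where `μ` ranges over all probability distributions on the entries. (Since
there are finitely many `g`, among them `f`, the supremum and the infimum are attained
when `0 ≤ ε` and `X`, `Y` are nonempty.) -/
noncomputable def bpPerturb {X Y : Type} [Fintype X] [Fintype Y] (ε : ℝ)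
    (Λ : (X → Y → Bool) → ℝ) (f : X → Y → Bool) : ℝ :=
  ⨆ μ : stdSimplex ℝ (X × Y),
    ⨅ g : {g : X → Y → Bool //
      (∑ p : X × Y with f p.1 p.2 ≠ g p.1 p.2, (μ : X × Y → ℝ) p) ≤ ε}, Λ g.1

/-- The class `M^cc` of languages of low mc-rigidity: the logarithm of the BP-perturbed margin
complexity (with error `1/3`) of the `n`-bit section is `polylog(n)`. -/
def Mcc : Set CommLanguage :=
  {L | IsPolylog fun n => Real.logb 2 (bpPerturb (1 / 3) mcBool (nSection L n))}

/-! ### PSPACE -/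

/-- `altQuant b [l₁, …, l_k] P` is `Q₁ u₁ Q₂ u₂ … Q_k u_k, P (u₁ u₂ … u_k)`, where `u_i` ranges
over the strings of length `l_i` and the quantifiers alternate, starting with `∃` if `b` is
`true` and with `∀` if `b` is `false`. -/
def altQuant : Bool → List ℕ → (List Bool → Prop) → Prop
  | _, [], P => P []
  | true, l :: ls, P => ∃ u : Word l, altQuant false ls fun w => P (List.ofFn u ++ w)
  | false, l :: ls, P => ∀ u : Word l, altQuant true ls fun w => P (List.ofFn u ++ w)

/-- The class `PSPACE^cc` of Babai, Frankl and Simon: `(x, y) ∈ L` iff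
`∃ u₁ ∀ u₂ … Q_k u_k, φ(x, u) ◇ ψ(y, u)`, where the number `k` of quantifier blocks and the total
length of `u = u₁ … u_k` are `polylog(n)`, and `◇` is `∨` if `k` is even and `∧` if `k` is odd. -/
def PSPACEcc : Set CommLanguage :=
  {L | ∃ ls : ℕ → List ℕ,
    IsPolylog (fun n => ((ls n).length : ℝ)) ∧ IsPolylog (fun n => ((ls n).sum : ℝ)) ∧
    ∃ φ ψ : (n : ℕ) → Word n → List Bool → Bool,
      ∀ n : ℕ, 1 ≤ n → ∀ x y : Word n,
        (⟨n, x, y⟩ : WordPair) ∈ L ↔ altQuant true (ls n) fun u =>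
          (Even (ls n).length ∧ (φ n x u = true ∨ ψ n y u = true)) ∨
          (¬ Even (ls n).length ∧ (φ n x u = true ∧ ψ n y u = true))}

end CommCC

/-!
The three classes are compared through one combinatorial object: integer matrices written as sums of
few rank-one sign matrices `(s x * t y)` (`HasRep`). If the sign of such a sum with `l` terms is the
Boolean matrix `g`, then guessing one of the terms is a PP protocol of cost `log l + O(1)`
(`ppComplexity_le`), and normalizing the sign vectors realizes `g` with margin `1 / l`
(`mcBool_le`). Conversely, a PP protocol of cost `c` gives such a sum with `4 ^ c` terms
(`exists_hasRep_ppComplexity`), and a realization with margin `γ` gives one with a number of terms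
polynomial in `1 / γ` and in the logarithm of the number of entries
(`exists_signRep_of_mcBool_lt`).

The last fact, and the passage from "for every distribution `μ` there is a close matrix of small
margin complexity" to a random matrix that is right at every entry with probability close to `2 / 3`
and needs few random bits, both come from the multiplicative weights lemma `exists_average_gt`,
which is the minimax theorem together with a logarithmic bound for the support of the strategy. For
margins, the required correlation under an arbitrary weighting is obtained by writing inner products
as averages of products of Rademacher sums, truncating these and rounding them to signs
(`exists_sign_correlation`).

Sampling costs a little of the success probability `2 / 3`. It is recovered by a majority vote of
three samples. The majority of three sign representations again has a short sign representation,
because the sign function is approximated on `1 ≤ |z| ≤ 2 ^ K` by a rational function of degree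
`O(K)` (`exists_signRep_maj`, following Beigel, Reingold and Spielman). This gives `Mcc_subset`. The
reverse inclusion `BPop_PPcc_subset_Mcc` is averaging over the random string.

For `BPop_PPcc_subset_PSPACEcc`, membership says that for more than half of the random strings more
than half of the terms of a sum of rank-one sign matrices are positive. A threshold condition
over `2 ^ k` objects is evaluated by `k` rounds in which an existential quantifier claims a lower
bound for the count in the first half and a universal quantifier chooses the half to be verified
(`Alt.le_count`). The three statements together refute the strict inclusion of `PSPACEcc` in `Mcc`.
-/

namespace CommCC

/-! ### Sums of rank-one sign matrices -/

/-- `HasRep F l`: the integer matrix `F` is a sum of at most `l` sign matrices of rank one, that is,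
of matrices `(s x * t y)` with `s` and `t` taking values in `{1, -1} = ℤˣ`. -/
def HasRep {X Y : Type} (F : X → Y → ℤ) (l : ℕ) : Prop :=
  ∃ k ≤ l, ∃ (s : Fin k → X → ℤˣ) (t : Fin k → Y → ℤˣ),
    ∀ x y, F x y = ∑ i, ((s i x * t i y : ℤˣ) : ℤ)

namespace HasRep

variable {X Y : Type} {F G : X → Y → ℤ} {l l' : ℕ}

theorem of_fintype {ι : Type*} [Fintype ι] (s : ι → X → ℤˣ) (t : ι → Y → ℤˣ)
    (hF : ∀ x y, F x y = ∑ i, ((s i x * t i y : ℤˣ) : ℤ)) (hl : Fintype.card ι ≤ l) :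
    HasRep F l := by
  refine ⟨Fintype.card ι, hl, fun i => s ((Fintype.equivFin ι).symm i),
    fun i => t ((Fintype.equivFin ι).symm i), fun x y => ?_⟩
  rw [hF, ← (Fintype.equivFin ι).symm.sum_comp]

theorem mono (h : HasRep F l) (hl : l ≤ l') : HasRep F l' := by
  obtain ⟨k, hk, h⟩ := h
  exact ⟨k, hk.trans hl, h⟩

theorem congr (h : HasRep F l) (hFG : ∀ x y, G x y = F x y) : HasRep G l := by
  obtain rfl : G = F := by
    ext x y
    exact hFG x y
  exact h

theorem rankOne (s : X → ℤˣ) (t : Y → ℤˣ) : HasRep (fun x y => ((s x * t y : ℤˣ) : ℤ)) 1 :=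
  of_fintype (ι := Unit) (fun _ => s) (fun _ => t) (by simp) (by simp)

theorem add (hF : HasRep F l) (hG : HasRep G l') :
    HasRep (fun x y => F x y + G x y) (l + l') := by
  obtain ⟨k, hk, s, t, h⟩ := hF
  obtain ⟨k', hk', s', t', h'⟩ := hG
  exact of_fintype (ι := Fin k ⊕ Fin k') (Sum.elim s s') (Sum.elim t t')
    (by simp [h, h']) (by simpa using by omega)

theorem mul (hF : HasRep F l) (hG : HasRep G l') :
    HasRep (fun x y => F x y * G x y) (l * l') := by
  obtain ⟨k, hk, s, t, h⟩ := hF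
  obtain ⟨k', hk', s', t', h'⟩ := hG
  refine of_fintype (ι := Fin k × Fin k') (fun i => s i.1 * s' i.2) (fun i => t i.1 * t' i.2)
    (fun x y => ?_) (by simpa using Nat.mul_le_mul hk hk')
  rw [h, h', Finset.sum_mul_sum, Fintype.sum_prod_type]
  refine Finset.sum_congr rfl fun i _ => Finset.sum_congr rfl fun j _ => ?_
  simp only [Pi.mul_apply, Units.val_mul]
  ring

theorem neg (hF : HasRep F l) : HasRep (fun x y => -F x y) l :=
  ((rankOne (fun _ : X => (-1 : ℤˣ)) (fun _ : Y => (1 : ℤˣ))).mul hF).congr (by simp) |>.mono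
    (by simp)

theorem sub (hF : HasRep F l) (hG : HasRep G l') :
    HasRep (fun x y => F x y - G x y) (l + l') :=
  (hF.add hG.neg).congr fun _ _ => sub_eq_add_neg _ _

theorem natCast (n : ℕ) : HasRep (fun (_ : X) (_ : Y) => (n : ℤ)) n :=
  of_fintype (ι := Fin n) (fun _ _ => 1) (fun _ _ => 1) (by simp) (by simp)

theorem sum {ι : Type*} [Fintype ι] {F : ι → X → Y → ℤ} (h : ∀ i, HasRep (F i) l) :
    HasRep (fun x y => ∑ i, F i x y) (Fintype.card ι * l) := by
  choose k hk s t h using h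
  refine of_fintype (ι := Σ i, Fin (k i)) (fun p => s p.1 p.2) (fun p => t p.1 p.2)
    (fun x y => ?_) ?_
  · simp only [h, Fintype.sum_sigma]
  · simpa using Finset.sum_le_card_nsmul Finset.univ k l fun i _ => hk i

theorem prod_range {F : ℕ → X → Y → ℤ} (n : ℕ) (h : ∀ i < n, HasRep (F i) l) :
    HasRep (fun x y => ∏ i ∈ Finset.range n, F i x y) (l ^ n) := by
  induction n with
  | zero => simpa using natCast (X := X) (Y := Y) 1
  | succ n ih =>
    simp only [Finset.prod_range_succ, pow_succ]
    exact (ih fun i hi => h i (by omega)).mul (h n (by omega))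

theorem comap {X' Y' : Type} (h : HasRep F l) (a : X' → X) (b : Y' → Y) :
    HasRep (fun x y => F (a x) (b y)) l := by
  obtain ⟨k, hk, s, t, h⟩ := h
  exact ⟨k, hk, fun i x => s i (a x), fun i y => t i (b y), fun x y => h _ _⟩

theorem abs_le (h : HasRep F l) (x : X) (y : Y) : |F x y| ≤ l := by
  obtain ⟨k, hk, s, t, h⟩ := h
  rw [h]
  calc |∑ i, ((s i x * t i y : ℤˣ) : ℤ)| ≤ ∑ i, |((s i x * t i y : ℤˣ) : ℤ)| :=
        Finset.abs_sum_le_sum_abs _ _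
    _ = k := by simp [Int.isUnit_iff_abs_eq.1 (Units.isUnit _)]
    _ ≤ l := by exact_mod_cast hk

/-- A matrix whose rows are taken from matrices `F r`, where `r = ρ x` depends on the row. The
indicator of `ρ x = r` is `(1 + s x) / 2` for a sign function `s`, which explains the factor `2`. -/
theorem select {R : Type} [Fintype R] {F : R → X → Y → ℤ} (h : ∀ r, HasRep (F r) l) (ρ : X → R) :
    HasRep (fun x y => 2 * F (ρ x) x y) (Fintype.card R * (2 * l)) := by
  classical
  have key (r : R) : HasRep (fun x y => (if ρ x = r then 2 else 0) * F r x y) (2 * l) := by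
    refine (((natCast 1).add (rankOne (fun x => if ρ x = r then 1 else -1) fun _ => 1)).congr
      fun x y => ?_).mul (h r)
    split_ifs <;> simp
  exact (sum key).congr fun x y => by simp

end HasRep

/-- The sign of a truth value: `1` for `true` and `-1` for `false`. -/
def sgn (b : Bool) : ℤˣ := if b then 1 else -1

/-- `F` represents the Boolean matrix `g` by its signs: it is nonzero everywhere, and positive
exactly where `g` is true. -/
def SignRep {X Y : Type} (F : X → Y → ℤ) (g : X → Y → Bool) : Prop :=
  ∀ x y, 0 < (sgn (g x y) : ℤ) * F x y

theorem SignRep.pos_iff {X Y : Type} {F : X → Y → ℤ} {g : X → Y → Bool} (h : SignRep F g)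
    (x : X) (y : Y) : g x y = true ↔ 0 < F x y := by
  have := h x y
  cases hg : g x y <;> simp [sgn, hg] at this ⊢ <;> omega

/-- Every Boolean matrix with finitely many rows is represented by a sum of sign matrices of
rank one. -/
theorem exists_signRep {X Y : Type} [Fintype X] (g : X → Y → Bool) :
    ∃ (F : X → Y → ℤ) (l : ℕ), HasRep F l ∧ SignRep F g := by
  refine ⟨_, _, HasRep.select (F := fun r x y => (((1 : X → ℤˣ) x * sgn (g r y) : ℤˣ) : ℤ))
    (fun r => HasRep.rankOne _ _) id, fun x y => ?_⟩
  cases h : g x y <;> simp [sgn, h]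

/-! ### Guess protocols and sums of rank-one sign matrices -/

/-- At an inner node where the sign `s` is sent, `2 * P = (R + L) + s * (R - L)` for the signs `L`
and `R` of the subtrees; hence the factor `2 ^ k`. -/
theorem Protocol.hasRep {X Y : Type} (P : Protocol X Y) (k : ℕ) (hk : P.cost ≤ k) :
    HasRep (fun x y => 2 ^ k * (sgn (P.eval x y) : ℤ)) (4 ^ k) := by
  induction P generalizing k with
  | leaf b =>
    refine (((HasRep.natCast (2 ^ k)).mul (HasRep.rankOne (fun _ => 1) fun _ => sgn b)).congr
      fun x y => ?_).mono ?_
    · simp [Protocol.eval]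
    · rw [mul_one]
      exact Nat.pow_le_pow_left (by norm_num) k
  | alice a l r ihl ihr =>
    rw [Protocol.cost] at hk
    obtain ⟨k, rfl⟩ : ∃ j, k = j + 1 := ⟨k - 1, by omega⟩
    have hl := ihl k (by omega)
    have hr := ihr k (by omega)
    have ha := HasRep.rankOne (fun x => sgn (a x)) fun _ : Y => (1 : ℤˣ)
    refine (((hl.add hr).add (ha.mul (hr.sub hl))).congr fun x y => ?_).mono (by ring_nf; rfl)
    cases h : a x <;> simp [Protocol.eval, h, sgn] <;> ring
  | bob b l r ihl ihr =>
    rw [Protocol.cost] at hk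
    obtain ⟨k, rfl⟩ : ∃ j, k = j + 1 := ⟨k - 1, by omega⟩
    have hl := ihl k (by omega)
    have hr := ihr k (by omega)
    have hb := HasRep.rankOne (fun _ : X => (1 : ℤˣ)) fun y => sgn (b y)
    refine (((hl.add hr).add (hb.mul (hr.sub hl))).congr fun x y => ?_).mono (by ring_nf; rfl)
    cases h : b y <;> simp [Protocol.eval, h, sgn] <;> ring

theorem GuessProtocol.acc_sub_rej {X Y : Type} (P : GuessProtocol X Y) (x : X) (y : Y) :
    (P.acc x y : ℤ) - P.rej x y = ∑ i, (sgn ((P.protocol i).eval x y) : ℤ) := by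
  simp only [acc, rej, Finset.card_filter, Nat.cast_sum, ← Finset.sum_sub_distrib]
  refine Finset.sum_congr rfl fun i _ => ?_
  cases (P.protocol i).eval x y <;> simp [sgn]

theorem GuessProtocol.exists_hasRep {X Y : Type} {P : GuessProtocol X Y} {f : X → Y → Bool}
    (h : P.ComputesPP f) :
    ∃ F : X → Y → ℤ, HasRep F (4 ^ P.cost) ∧ ∀ x y, f x y = true ↔ 0 < F x y := by
  set D := Finset.univ.sup fun i => (P.protocol i).cost with hD
  have hrep := HasRep.sum fun i => (P.protocol i).hasRep D
    (Finset.le_sup (f := fun i => (P.protocol i).cost) (Finset.mem_univ i))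
  refine ⟨_, hrep.mono ?_, fun x y => ?_⟩
  · rw [Fintype.card_fin, cost, pow_add, ← hD]
    refine Nat.mul_le_mul_right _ ((Nat.le_pow_clog one_lt_two _).trans ?_)
    exact Nat.pow_le_pow_left (by norm_num) _
  · rw [h, ← Finset.mul_sum, ← P.acc_sub_rej]
    have : (0 : ℤ) < 2 ^ D := by positivity
    rw [mul_pos_iff_of_pos_left this]
    omega

/-- The protocol in which Alice and Bob send the signs `s x` and `t y`; it accepts if their
product is `1`. -/
def rankOneProtocol {X Y : Type} (s : X → ℤˣ) (t : Y → ℤˣ) : Protocol X Y :=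
  .alice (fun x => decide (s x = 1))
    (.bob (fun y => decide (t y = 1)) (.leaf true) (.leaf false))
    (.bob (fun y => decide (t y = 1)) (.leaf false) (.leaf true))

theorem sgn_eval_rankOneProtocol {X Y : Type} (s : X → ℤˣ) (t : Y → ℤˣ) (x : X) (y : Y) :
    sgn ((rankOneProtocol s t).eval x y) = s x * t y := by
  rcases Int.units_eq_one_or (s x) with h | h <;> rcases Int.units_eq_one_or (t y) with h' | h' <;>
    simp [rankOneProtocol, Protocol.eval, sgn, h, h']

theorem ppComplexity_eq_zero {X Y : Type} {f : X → Y → Bool} (h : ∀ x y, f x y = false) :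
    ppComplexity f = 0 := by
  refine Nat.sInf_eq_zero.2 (.inl ?_)
  refine ⟨⟨1, one_pos, fun _ => .leaf false⟩, fun x y => ?_, ?_⟩
  · simp [h, GuessProtocol.acc, GuessProtocol.rej, Protocol.eval]
  · simp [GuessProtocol.cost, Protocol.cost]

theorem exists_computesPP {X Y : Type} {F : X → Y → ℤ} {l : ℕ} (hF : HasRep F l)
    {f : X → Y → Bool} (hf : ∀ x y, f x y = true ↔ 0 < F x y) :
    ∃ P : GuessProtocol X Y, P.ComputesPP f ∧ P.cost ≤ Nat.clog 2 l + 2 := by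
  obtain ⟨k, hk, s, t, h⟩ := hF
  rcases Nat.eq_zero_or_pos k with rfl | hk0
  · refine ⟨⟨1, one_pos, fun _ => .leaf false⟩, fun x y => ?_, ?_⟩
    · simp [hf, h, GuessProtocol.acc, GuessProtocol.rej, Protocol.eval]
    · simp [GuessProtocol.cost, Protocol.cost]
  · refine ⟨⟨k, hk0, fun i => rankOneProtocol (s i) (t i)⟩, fun x y => ?_, ?_⟩
    · have := GuessProtocol.acc_sub_rej ⟨k, hk0, fun i => rankOneProtocol (s i) (t i)⟩ x y
      simp only [sgn_eval_rankOneProtocol, ← h] at this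
      rw [hf]
      omega
    · refine Nat.add_le_add (Nat.clog_mono_right _ hk) (Finset.sup_le fun i _ => ?_)
      simp [rankOneProtocol, Protocol.cost]

theorem ppComplexity_le {X Y : Type} {F : X → Y → ℤ} {l : ℕ} (hF : HasRep F l)
    {f : X → Y → Bool} (hf : ∀ x y, f x y = true ↔ 0 < F x y) :
    ppComplexity f ≤ Nat.clog 2 l + 2 := by
  obtain ⟨P, hP, hc⟩ := exists_computesPP hF hf
  refine le_trans (Nat.sInf_le ?_) hc
  exact ⟨P, hP, rfl⟩

theorem exists_hasRep_ppComplexity {X Y : Type} [Fintype X] (f : X → Y → Bool) :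
    ∃ F : X → Y → ℤ, HasRep F (4 ^ ppComplexity f) ∧ ∀ x y, f x y = true ↔ 0 < F x y := by
  obtain ⟨F, l, hF, hf⟩ := exists_signRep f
  obtain ⟨P, hP, -⟩ := exists_computesPP hF hf.pos_iff
  obtain ⟨P, hP, hc⟩ := Nat.sInf_mem (s := {c | ∃ P : GuessProtocol X Y, P.ComputesPP f ∧
    P.cost = c}) ⟨_, P, hP, rfl⟩
  rw [ppComplexity, ← hc]
  exact GuessProtocol.exists_hasRep hP

/-! ### Majority of three sign representations -/

/-- The majority of three truth values. -/
def maj (a b c : Bool) : Bool := (a && b) || (a && c) || (b && c)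

/-- The polynomial `∏ (z - 2 ^ i) ^ 2` over `i ≤ K`. It is much smaller at `z` than at `-z` for
`1 ≤ z ≤ 2 ^ K`. -/
def sep (K : ℕ) (z : ℤ) : ℤ := ∏ i ∈ Finset.range (K + 1), (z - 2 ^ i) ^ 2

theorem sep_nonneg (K : ℕ) (z : ℤ) : 0 ≤ sep K z := Finset.prod_nonneg fun _ _ => sq_nonneg _

theorem sep_neg_pos (K : ℕ) {z : ℤ} (hz : 0 < z) : 0 < sep K (-z) := by
  refine Finset.prod_pos fun i _ => ?_
  have : (0 : ℤ) < 2 ^ i := by positivity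
  exact sq_pos_of_neg (by omega)

/-- If `2 ^ j ≤ z ≤ 2 ^ (j + 1)`, then `3 * (z - 2 ^ j) ≤ z + 2 ^ j`, so that the `j`-th factor
alone makes a difference of `9`. -/
theorem nine_mul_sep_le (K : ℕ) {z : ℤ} (hz : 0 < z) (hzK : z ≤ 2 ^ K) :
    9 * sep K z ≤ sep K (-z) := by
  obtain ⟨z, rfl⟩ := Int.eq_ofNat_of_zero_le hz.le
  have hz0 : z ≠ 0 := by omega
  set j := Nat.log 2 z with hj
  have h1 : 2 ^ j ≤ z := Nat.pow_log_le_self 2 hz0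
  have h2 : z < 2 ^ (j + 1) := Nat.lt_pow_succ_log_self one_lt_two z
  have hjK : j ∈ Finset.range (K + 1) := by
    have : 2 ^ j ≤ 2 ^ K := h1.trans (by exact_mod_cast hzK)
    have := (Nat.pow_le_pow_iff_right (a := 2) (by norm_num)).1 this
    simp only [Finset.mem_range]
    omega
  rw [sep, sep, ← Finset.mul_prod_erase _ _ hjK, ← Finset.mul_prod_erase _ _ hjK, ← mul_assoc]
  refine mul_le_mul ?_ (Finset.prod_le_prod (fun _ _ => sq_nonneg _) fun i _ => ?_)
    (Finset.prod_nonneg fun _ _ => sq_nonneg _) (sq_nonneg _)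
  · have h1' : (2 : ℤ) ^ j ≤ z := by exact_mod_cast h1
    have h2' : (z : ℤ) < 2 * 2 ^ j := by
      have : z < 2 * 2 ^ j := by rw [← pow_succ']; exact h2
      exact_mod_cast this
    nlinarith
  · have : (0 : ℤ) < 2 ^ i := by positivity
    nlinarith

theorem HasRep.sep {X Y : Type} {F : X → Y → ℤ} {K : ℕ} (hF : HasRep F (2 ^ K)) :
    HasRep (fun x y => sep K (F x y)) (2 ^ (2 * (K + 1) ^ 2)) := by
  have : HasRep (fun x y => CommCC.sep K (F x y)) (((2 ^ (K + 1)) ^ 2) ^ (K + 1)) := by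
    refine HasRep.prod_range (F := fun i x y => (F x y - 2 ^ i) ^ 2) _ fun i hi => ?_
    have h : HasRep (fun x y => F x y - 2 ^ i) (2 ^ (K + 1)) :=
      ((hF.sub (HasRep.natCast (2 ^ i))).congr (by simp)).mono (by
        rw [pow_succ, mul_two]
        exact Nat.add_le_add_left (Nat.pow_le_pow_right two_pos (by omega)) _)
    exact ((h.mul h).congr fun x y => sq _).mono (sq _).ge
  refine this.mono (le_of_eq ?_)
  rw [← pow_mul, ← pow_mul]
  ring_nf

/-- The rational function `(sep K (-z) - sep K z) / (sep K (-z) + sep K z)` approximates the sign of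
`z` up to `1 / 5`; this is the form in which that is used. -/
theorem sep_sign {K : ℕ} {z : ℤ} {b : Bool} (hz : 0 < (sgn b : ℤ) * z) (hzK : |z| ≤ 2 ^ K) :
    0 < sep K (-z) + sep K z ∧
      4 * (sep K (-z) + sep K z) ≤ 5 * ((sgn b : ℤ) * (sep K (-z) - sep K z)) ∧
      (sgn b : ℤ) * (sep K (-z) - sep K z) ≤ sep K (-z) + sep K z := by
  have := sep_nonneg K z
  have := sep_nonneg K (-z)
  cases b
  · simp only [sgn, Bool.false_eq_true, if_false, Units.val_neg, Units.val_one] at *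
    have h := nine_mul_sep_le K (z := -z) (by omega) ((neg_le_abs z).trans hzK)
    have h' := sep_neg_pos K (z := -z) (by omega)
    rw [neg_neg] at h h'
    omega
  · simp only [sgn, if_true, Units.val_one] at *
    have h := nine_mul_sep_le K (z := z) (by omega) ((le_abs_self z).trans hzK)
    have h' := sep_neg_pos K (z := z) (by omega)
    omega

theorem maj_pos {a b c : Bool} {A₁ A₂ A₃ B₁ B₂ B₃ : ℤ}
    (h₁ : 0 < B₁ ∧ 4 * B₁ ≤ 5 * ((sgn a : ℤ) * A₁) ∧ (sgn a : ℤ) * A₁ ≤ B₁)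
    (h₂ : 0 < B₂ ∧ 4 * B₂ ≤ 5 * ((sgn b : ℤ) * A₂) ∧ (sgn b : ℤ) * A₂ ≤ B₂)
    (h₃ : 0 < B₃ ∧ 4 * B₃ ≤ 5 * ((sgn c : ℤ) * A₃) ∧ (sgn c : ℤ) * A₃ ≤ B₃) :
    0 < (sgn (maj a b c) : ℤ) * (A₁ * (B₂ * B₃) + A₂ * (B₁ * B₃) + A₃ * (B₁ * B₂)) := by
  have h12 := mul_pos h₁.1 h₂.1
  have h13 := mul_pos h₁.1 h₃.1
  have h23 := mul_pos h₂.1 h₃.1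
  have h123 := mul_pos h₁.1 h23
  have e₁ := mul_le_mul_of_nonneg_right h₁.2.1 h23.le
  have e₂ := mul_le_mul_of_nonneg_right h₂.2.1 h13.le
  have e₃ := mul_le_mul_of_nonneg_right h₃.2.1 h12.le
  have g₁ := mul_le_mul_of_nonneg_right h₁.2.2 h23.le
  have g₂ := mul_le_mul_of_nonneg_right h₂.2.2 h13.le
  have g₃ := mul_le_mul_of_nonneg_right h₃.2.2 h12.le
  cases a <;> cases b <;> cases c <;> simp [sgn, maj] at * <;> nlinarith

/-- A sign representation of the majority of three sign-represented matrices: the signs are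
approximated by rational functions, and their sum is cleared of (positive) denominators. -/
theorem exists_signRep_maj {X Y : Type} {F : Fin 3 → X → Y → ℤ} {g : Fin 3 → X → Y → Bool}
    {K : ℕ} (hF : ∀ i, HasRep (F i) (2 ^ K)) (hg : ∀ i, SignRep (F i) (g i)) :
    ∃ G : X → Y → ℤ, HasRep G (2 ^ (6 * (K + 1) ^ 2 + 5)) ∧
      SignRep G fun x y => maj (g 0 x y) (g 1 x y) (g 2 x y) := by
  have hA (i) := (hF i).neg.sep.sub (hF i).sep
  have hB (i) := (hF i).neg.sep.add (hF i).sep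
  refine ⟨_, ((((hA 0).mul ((hB 1).mul (hB 2))).add ((hA 1).mul ((hB 0).mul (hB 2)))).add
    ((hA 2).mul ((hB 0).mul (hB 1)))).mono ?_, fun x y => ?_⟩
  · have : 2 ^ (6 * (K + 1) ^ 2 + 5) = 32 * (2 ^ (2 * (K + 1) ^ 2)) ^ 3 := by
      rw [← pow_mul, pow_add]
      ring_nf
    rw [this]
    generalize 2 ^ (2 * (K + 1) ^ 2) = c
    ring_nf
    omega
  · have h (i) := sep_sign (hg i x y) (K := K) (by simpa using (hF i).abs_le x y)
    exact maj_pos (h 0) (h 1) (h 2)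

/-! ### Minimax with small support -/

/-- If against every positive weighting `w` of the points `z` some `i` achieves a `w`-average of at
least `v`, then `T` suitable indices achieve an average of more than `v - δ` at every point
simultaneously, where `T` is logarithmic in the number of points. The indices are chosen one by
one by the method of multiplicative weights, which keeps the potential
`∑ z, exp (-(δ / 8) * ∑ j, (h (f j) z - v))` below `|Z| * exp (δ ^ 2 * T / 16)`. -/
theorem exists_average_gt {Z ι : Type*} [Fintype Z] [Nonempty Z] {h : ι → Z → ℝ} {v δ : ℝ}
    (hh : ∀ i z, |h i z| ≤ 1) (hv : |v| ≤ 1) (hδ : 0 < δ) (hδ1 : δ ≤ 1)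
    (hw : ∀ w : Z → ℝ, (∀ z, 0 < w z) → ∃ i, v * ∑ z, w z ≤ ∑ z, w z * h i z)
    {T : ℕ} (hT : 16 * Real.log (Fintype.card Z) < δ ^ 2 * T) :
    ∃ f : Fin T → ι, ∀ z, (v - δ) * T < ∑ j, h (f j) z := by
  have key (T : ℕ) : ∃ f : Fin T → ι,
      ∑ z, Real.exp (-(δ / 8) * ∑ j, (h (f j) z - v)) ≤
        Fintype.card Z * Real.exp (δ ^ 2 / 16 * T) := by
    induction T with
    | zero => exact ⟨Fin.elim0, by simp⟩
    | succ T ih =>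
      obtain ⟨f, hf⟩ := ih
      set w : Z → ℝ := fun z => Real.exp (-(δ / 8) * ∑ j, (h (f j) z - v)) with hw_def
      obtain ⟨i, hi⟩ := hw w fun z => Real.exp_pos _
      refine ⟨Fin.snoc f i, ?_⟩
      -- For `|a| ≤ 1`, `exp a ≤ 1 + a + a ^ 2`, and here `a ^ 2 ≤ (δ / 4) ^ 2`.
      have hstep (z : Z) : Real.exp (-(δ / 8) * ∑ j, (h ((Fin.snoc f i : Fin (T + 1) → ι) j) z - v))
          ≤ w z * (1 + δ ^ 2 / 16) - δ / 8 * (w z * h i z - v * w z) := by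
        have hd : |h i z - v| ≤ 2 := (abs_sub _ _).trans (by linarith [hh i z])
        have hx : |-(δ / 8) * (h i z - v)| ≤ δ / 4 := by
          rw [abs_mul, abs_neg, abs_of_pos (by positivity)]
          nlinarith
        have hexp : Real.exp (-(δ / 8) * (h i z - v)) ≤
            1 + -(δ / 8) * (h i z - v) + δ ^ 2 / 16 := by
          have h1 := Real.abs_exp_sub_one_sub_id_le (hx.trans (by linarith))
          have h2 : (-(δ / 8) * (h i z - v)) ^ 2 ≤ (δ / 4) ^ 2 := sq_le_sq' (by
            linarith [neg_abs_le (-(δ / 8) * (h i z - v))]) ((le_abs_self _).trans hx)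
          linarith [le_abs_self (Real.exp (-(δ / 8) * (h i z - v)) - 1 - -(δ / 8) * (h i z - v))]
        rw [Fin.sum_univ_castSucc]
        simp only [Fin.snoc_castSucc, Fin.snoc_last]
        rw [mul_add, Real.exp_add]
        calc _ ≤ w z * (1 + -(δ / 8) * (h i z - v) + δ ^ 2 / 16) :=
              mul_le_mul_of_nonneg_left hexp (Real.exp_pos _).le
          _ = _ := by ring
      calc _ ≤ ∑ z, (w z * (1 + δ ^ 2 / 16) - δ / 8 * (w z * h i z - v * w z)) :=
            Finset.sum_le_sum fun z _ => hstep z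
        _ = (∑ z, w z) * (1 + δ ^ 2 / 16) - δ / 8 * (∑ z, w z * h i z - v * ∑ z, w z) := by
            rw [Finset.sum_sub_distrib, ← Finset.sum_mul, ← Finset.mul_sum,
              Finset.sum_sub_distrib, ← Finset.mul_sum]
        _ ≤ (∑ z, w z) * (1 + δ ^ 2 / 16) := by
            have : 0 ≤ δ / 8 * (∑ z, w z * h i z - v * ∑ z, w z) :=
              mul_nonneg (by positivity) (by linarith)
            linarith
        _ ≤ (Fintype.card Z * Real.exp (δ ^ 2 / 16 * T)) * Real.exp (δ ^ 2 / 16) := by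
            refine mul_le_mul hf ?_ (by positivity) (by positivity)
            linarith [Real.add_one_le_exp (δ ^ 2 / 16)]
        _ = _ := by
            rw [mul_assoc, ← Real.exp_add]
            push_cast
            ring_nf
  obtain ⟨f, hf⟩ := key T
  refine ⟨f, fun z => ?_⟩
  have h1 := (Finset.single_le_sum (f := fun z => Real.exp (-(δ / 8) * ∑ j, (h (f j) z - v)))
    (fun z _ => (Real.exp_pos _).le) (Finset.mem_univ z)).trans hf
  have hcard : (0 : ℝ) < Fintype.card Z := by exact_mod_cast Fintype.card_pos
  rw [← Real.exp_log hcard, ← Real.exp_add, Real.exp_le_exp, Finset.sum_sub_distrib] at h1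
  simp only [Finset.sum_const, Finset.card_univ, Fintype.card_fin, nsmul_eq_mul] at h1
  -- Otherwise the term of `z` alone is at least `exp (δ ^ 2 * T / 8)`.
  by_contra! hcon
  have : δ * (δ * T) ≤ δ * (T * v - ∑ j, h (f j) z) :=
    mul_le_mul_of_nonneg_left (by linarith) hδ.le
  nlinarith

/-! ### Rounding a margin to a correlation with a rank-one sign matrix -/

theorem sum_signVector_succ {d : ℕ} (F : (Fin (d + 1) → ℤˣ) → ℝ) :
    ∑ e, F e = ∑ e : Fin d → ℤˣ, (F (Fin.cons 1 e) + F (Fin.cons (-1) e)) := by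
  rw [← (Fin.consEquiv fun _ : Fin (d + 1) => ℤˣ).sum_comp, Fintype.sum_prod_type,
    Finset.sum_add_distrib]
  have : (Finset.univ : Finset ℤˣ) = {1, -1} := by decide
  rw [this, Finset.sum_pair (by decide)]
  rfl

/-- The signed sum `∑ i, ± u i`. -/
def signedSum {d : ℕ} (u : Fin d → ℝ) (e : Fin d → ℤˣ) : ℝ := ∑ i, ((e i : ℤ) : ℝ) * u i

theorem signedSum_cons {d : ℕ} (u : Fin (d + 1) → ℝ) (a : ℤˣ) (e : Fin d → ℤˣ) :
    signedSum u (Fin.cons a e) = ((a : ℤ) : ℝ) * u 0 + signedSum (fun i => u i.succ) e := by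
  simp [signedSum, Fin.sum_univ_succ]

theorem sum_signedSum_mul {d : ℕ} (u v : Fin d → ℝ) :
    ∑ e, signedSum u e * signedSum v e = 2 ^ d * ∑ i, u i * v i := by
  induction d with
  | zero => simp [signedSum]
  | succ d ih =>
    rw [sum_signVector_succ, Fin.sum_univ_succ, mul_add, pow_succ', mul_assoc, mul_assoc,
      ← ih (fun i => u i.succ) fun i => v i.succ]
    simp only [signedSum_cons]
    calc _ = ∑ e : Fin d → ℤˣ, (2 * (u 0 * v 0) +
          2 * (signedSum (fun i => u i.succ) e * signedSum (fun i => v i.succ) e)) :=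
          Finset.sum_congr rfl fun e _ => by push_cast; ring
      _ = _ := by
          rw [Finset.sum_add_distrib, Finset.mul_sum]
          simp [mul_left_comm]

theorem sum_signedSum_pow_four_le {d : ℕ} (u : Fin d → ℝ) :
    ∑ e, signedSum u e ^ 4 ≤ 2 ^ d * (3 * (∑ i, u i ^ 2) ^ 2) := by
  induction d with
  | zero => simp [signedSum]
  | succ d ih =>
    have h4 := ih fun i => u i.succ
    have h2 := sum_signedSum_mul (fun i => u i.succ) fun i => u i.succ
    simp only [← sq] at h2
    rw [sum_signVector_succ, Fin.sum_univ_succ]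
    simp only [signedSum_cons]
    set S := ∑ i : Fin d, u i.succ ^ 2
    calc _ = ∑ e : Fin d → ℤˣ, (2 * u 0 ^ 4 + 12 * u 0 ^ 2 * signedSum (fun i => u i.succ) e ^ 2 +
          2 * signedSum (fun i => u i.succ) e ^ 4) :=
          Finset.sum_congr rfl fun e _ => by push_cast; ring
      _ = 2 ^ d * (2 * u 0 ^ 4) + 12 * u 0 ^ 2 * (2 ^ d * S) +
          2 * ∑ e, signedSum (fun i => u i.succ) e ^ 4 := by
          rw [Finset.sum_add_distrib, Finset.sum_add_distrib, ← Finset.mul_sum, ← Finset.mul_sum,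
            ← Finset.mul_sum, h2]
          simp [mul_left_comm]
      _ ≤ 2 ^ d * (2 * u 0 ^ 4) + 12 * u 0 ^ 2 * (2 ^ d * S) + 2 * (2 ^ d * (3 * S ^ 2)) := by
          linarith
      _ ≤ _ := by
          have : 0 ≤ (2 : ℝ) ^ d * u 0 ^ 4 := by positivity
          rw [pow_succ (2 : ℝ) d]
          nlinarith

/-- The truncation of `a` to the interval `[-M, M]`. -/
def trunc (M a : ℝ) : ℝ := max (-M) (min a M)

theorem abs_trunc_le {M : ℝ} (hM : 0 ≤ M) (a : ℝ) : |trunc M a| ≤ M :=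
  abs_le.2 ⟨le_max_left _ _, max_le (by linarith) (min_le_right _ _)⟩

theorem abs_trunc_le_abs {M : ℝ} (hM : 0 ≤ M) (a : ℝ) : |trunc M a| ≤ |a| := by
  unfold trunc
  rcases max_cases (-M) (min a M) with ⟨h, h'⟩ | ⟨h, h'⟩ <;>
    rcases min_cases a M with ⟨k, k'⟩ | ⟨k, k'⟩ <;> rw [h]
  all_goals
    rcases abs_cases a with ⟨e, e'⟩ | ⟨e, e'⟩ <;> rw [e] <;> rw [abs_le] <;>
      constructor <;> linarith

theorem abs_sub_trunc_le {M : ℝ} (hM : 0 < M) (a : ℝ) : |a - trunc M a| ≤ a ^ 2 / (4 * M) := by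
  rw [le_div_iff₀ (by positivity)]
  unfold trunc
  rcases max_cases (-M) (min a M) with ⟨h, h'⟩ | ⟨h, h'⟩
  · rw [h, abs_of_nonpos]
    · nlinarith [sq_nonneg (a + 2 * M)]
    · rcases min_cases a M with ⟨k, k'⟩ | ⟨k, k'⟩ <;> linarith
  · rw [h]
    rcases min_cases a M with ⟨k, k'⟩ | ⟨k, k'⟩ <;> rw [k]
    · simpa using sq_nonneg a
    · rw [abs_of_pos (by linarith)]
      nlinarith [sq_nonneg (a - 2 * M)]

theorem abs_mul_sub_trunc_le {M : ℝ} (hM : 0 < M) (a b : ℝ) :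
    |a * b - trunc M a * trunc M b| ≤ (a ^ 4 + a ^ 2 + b ^ 4 + b ^ 2) / (8 * M) := by
  have h1 : |a * b - trunc M a * trunc M b| ≤ a ^ 2 / (4 * M) * |b| + |a| * (b ^ 2 / (4 * M)) :=
    calc _ = |(a - trunc M a) * b + trunc M a * (b - trunc M b)| := by ring_nf
      _ ≤ |a - trunc M a| * |b| + |trunc M a| * |b - trunc M b| := by
          rw [← abs_mul, ← abs_mul]
          exact abs_add_le _ _
      _ ≤ _ := add_le_add (mul_le_mul_of_nonneg_right (abs_sub_trunc_le hM a) (abs_nonneg _))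
          (mul_le_mul (abs_trunc_le_abs hM.le a) (abs_sub_trunc_le hM b) (abs_nonneg _)
            (abs_nonneg _))
  refine h1.trans ?_
  have e : a ^ 2 / (4 * M) * |b| + |a| * (b ^ 2 / (4 * M)) =
      (2 * (a ^ 2 * |b|) + 2 * (|a| * b ^ 2)) / (8 * M) := by
    field_simp
    ring
  rw [e]
  refine div_le_div_of_nonneg_right ?_ (by positivity)
  nlinarith [sq_nonneg (a ^ 2 - |b|), sq_nonneg (b ^ 2 - |a|), sq_abs a, sq_abs b]

/-- A linear form on the cube `[-M, M] ^ X` is bounded by its value at a vertex. -/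
theorem exists_sign_sum_mul_le {X : Type*} [Fintype X] {M : ℝ} {a : X → ℝ}
    (ha : ∀ x, |a x| ≤ M) (c : X → ℝ) :
    ∃ s : X → ℤˣ, ∑ x, a x * c x ≤ M * ∑ x, ((s x : ℤ) : ℝ) * c x := by
  refine ⟨fun x => if 0 ≤ c x then 1 else -1, ?_⟩
  rw [Finset.mul_sum]
  refine Finset.sum_le_sum fun x _ => ?_
  have h := abs_le.1 (ha x)
  dsimp only
  split_ifs with hc
  · simpa using mul_le_mul_of_nonneg_right h.2 hc
  · push Not at hc
    push_cast
    nlinarith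

/-- A bilinear form is bounded on a product of two cubes by its value at a pair of vertices. -/
theorem exists_sign_sum_sum_mul_le {X Y : Type*} [Fintype X] [Fintype Y] {M : ℝ} (hM : 0 ≤ M)
    {a : X → ℝ} {b : Y → ℝ} (ha : ∀ x, |a x| ≤ M) (hb : ∀ y, |b y| ≤ M) (c : X → Y → ℝ) :
    ∃ (s : X → ℤˣ) (t : Y → ℤˣ), ∑ x, ∑ y, c x y * (a x * b y) ≤
      M ^ 2 * ∑ x, ∑ y, c x y * ((s x * t y : ℤˣ) : ℤ) := by
  obtain ⟨s, hs⟩ := exists_sign_sum_mul_le ha fun x => ∑ y, c x y * b y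
  obtain ⟨t, ht⟩ := exists_sign_sum_mul_le hb fun y => ∑ x, c x y * ((s x : ℤ) : ℝ)
  refine ⟨s, t, ?_⟩
  calc _ = ∑ x, a x * ∑ y, c x y * b y := by
        simp only [Finset.mul_sum]
        exact Finset.sum_congr rfl fun x _ => Finset.sum_congr rfl fun y _ => by ring
    _ ≤ M * ∑ x, ((s x : ℤ) : ℝ) * ∑ y, c x y * b y := hs
    _ = M * ∑ y, b y * ∑ x, c x y * ((s x : ℤ) : ℝ) := by
        simp only [Finset.mul_sum]
        rw [Finset.sum_comm]
        exact Finset.sum_congr rfl fun x _ => Finset.sum_congr rfl fun y _ => by ring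
    _ ≤ M * (M * ∑ y, ((t y : ℤ) : ℝ) * ∑ x, c x y * ((s x : ℤ) : ℝ)) :=
        mul_le_mul_of_nonneg_left ht hM
    _ = _ := by
        simp only [Finset.mul_sum]
        rw [Finset.sum_comm]
        refine Finset.sum_congr rfl fun x _ => Finset.sum_congr rfl fun y _ => ?_
        push_cast
        ring

/-- A matrix realized by unit vectors with margin `γ` against the signs `σ` has, for every
weighting of its entries, weighted correlation at least `γ ^ 3 / 8` with some rank-one sign matrix.
The inner products are averages of products of signed sums; these are truncated at `2 / γ`, which by
the bound on their fourth moments halves the margin at most, and rounded to signs by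
bilinearity. -/
theorem exists_sign_correlation {X Y : Type*} [Fintype X] [Fintype Y] {d : ℕ} {γ : ℝ} (hγ : 0 < γ)
    {u : X → EuclideanSpace ℝ (Fin d)} {v : Y → EuclideanSpace ℝ (Fin d)}
    (hu : ∀ x, ‖u x‖ = 1) (hv : ∀ y, ‖v y‖ = 1) (σ : X → Y → ℤˣ)
    (h : ∀ x y, γ ≤ ((σ x y : ℤ) : ℝ) * inner ℝ (u x) (v y))
    {w : X → Y → ℝ} (hw : ∀ x y, 0 ≤ w x y) :
    ∃ (s : X → ℤˣ) (t : Y → ℤˣ), γ ^ 3 / 8 * ∑ x, ∑ y, w x y ≤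
      ∑ x, ∑ y, w x y * (((σ x y : ℤ) : ℝ) * ((s x * t y : ℤˣ) : ℤ)) := by
  set M := 2 / γ with hM_def
  have hM : 0 < M := by positivity
  have hu' (x) : ∑ i, u x i ^ 2 = 1 := by
    rw [← EuclideanSpace.real_norm_sq_eq, hu, one_pow]
  have hv' (y) : ∑ i, v y i ^ 2 = 1 := by
    rw [← EuclideanSpace.real_norm_sq_eq, hv, one_pow]
  have hinner (x y) : inner ℝ (u x) (v y) = ∑ i, u x i * v y i := by
    simp [PiLp.inner_apply, mul_comm]
  have hpoint (x y) : 2 ^ d * (γ / 2) ≤ ∑ e : Fin d → ℤˣ, ((σ x y : ℤ) : ℝ) *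
      (trunc M (signedSum (u x) e) * trunc M (signedSum (v y) e)) := by
    have h1 (e : Fin d → ℤˣ) : ((σ x y : ℤ) : ℝ) * (signedSum (u x) e * signedSum (v y) e) -
        (signedSum (u x) e ^ 4 + signedSum (u x) e ^ 2 + signedSum (v y) e ^ 4 +
          signedSum (v y) e ^ 2) / (8 * M) ≤ ((σ x y : ℤ) : ℝ) *
      (trunc M (signedSum (u x) e) * trunc M (signedSum (v y) e)) := by
      have := abs_le.1 (abs_mul_sub_trunc_le hM (signedSum (u x) e) (signedSum (v y) e))
      rcases Int.units_eq_one_or (σ x y) with hs | hs <;> rw [hs] <;> push_cast <;> linarith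
    refine le_trans ?_ (Finset.sum_le_sum fun e _ => h1 e)
    rw [Finset.sum_sub_distrib, ← Finset.mul_sum, ← Finset.sum_div, Finset.sum_add_distrib,
      Finset.sum_add_distrib, Finset.sum_add_distrib, sum_signedSum_mul]
    have e1 := sum_signedSum_pow_four_le (u x)
    have e2 := sum_signedSum_pow_four_le (v y)
    have e3 := sum_signedSum_mul (u x) (u x)
    have e4 := sum_signedSum_mul (v y) (v y)
    simp only [← sq, hu', hv'] at e1 e2 e3 e4
    rw [e3, e4]
    -- The loss by truncation is at most `(3 + 1 + 3 + 1) / (8 * M) = γ / 2` on average.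
    have h2 : (∑ e, signedSum (u x) e ^ 4 + 2 ^ d * 1 + ∑ e, signedSum (v y) e ^ 4 + 2 ^ d * 1) /
        (8 * M) ≤ 2 ^ d * (γ / 2) := by
      rw [div_le_iff₀ (by positivity)]
      have : (2 : ℝ) ^ d * (γ / 2) * (8 * M) = 8 * 2 ^ d := by
        rw [hM_def]
        field_simp
      rw [this]
      linarith
    have h3 := mul_le_mul_of_nonneg_left (h x y) (pow_nonneg zero_le_two d : (0 : ℝ) ≤ 2 ^ d)
    rw [hinner] at h3
    linarith
  obtain ⟨e, -, he⟩ : ∃ e ∈ (Finset.univ : Finset (Fin d → ℤˣ)), γ / 2 * ∑ x, ∑ y, w x y ≤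
      ∑ x, ∑ y, w x y * ((σ x y : ℤ) : ℝ) *
        (trunc M (signedSum (u x) e) * trunc M (signedSum (v y) e)) := by
    refine Finset.exists_le_of_sum_le Finset.univ_nonempty ?_
    have hcard : (Finset.univ : Finset (Fin d → ℤˣ)).card = 2 ^ d := by simp
    have hcomm : ∑ e : Fin d → ℤˣ, ∑ x, ∑ y, w x y * ((σ x y : ℤ) : ℝ) *
        (trunc M (signedSum (u x) e) * trunc M (signedSum (v y) e)) = ∑ x, ∑ y, w x y *
          ∑ e : Fin d → ℤˣ, ((σ x y : ℤ) : ℝ) *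
            (trunc M (signedSum (u x) e) * trunc M (signedSum (v y) e)) := by
      rw [Finset.sum_comm]
      refine Finset.sum_congr rfl fun x _ => ?_
      rw [Finset.sum_comm]
      simp only [mul_assoc, ← Finset.mul_sum]
    rw [Finset.sum_const, hcard, nsmul_eq_mul, hcomm]
    rw [Finset.mul_sum, Finset.mul_sum]
    refine Finset.sum_le_sum fun x _ => ?_
    rw [Finset.mul_sum, Finset.mul_sum]
    refine Finset.sum_le_sum fun y _ => ?_
    have := mul_le_mul_of_nonneg_left (hpoint x y) (hw x y)
    push_cast
    linarith
  obtain ⟨s, t, hst⟩ := exists_sign_sum_sum_mul_le hM.le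
    (fun x => abs_trunc_le hM.le (signedSum (u x) e))
    (fun y => abs_trunc_le hM.le (signedSum (v y) e)) fun x y => w x y * ((σ x y : ℤ) : ℝ)
  refine ⟨s, t, ?_⟩
  have h1 := he.trans hst
  simp only [mul_assoc] at h1
  have h2 := mul_le_mul_of_nonneg_left h1 (by positivity : 0 ≤ γ ^ 2 / 4)
  have h3 : γ ^ 2 / 4 * M ^ 2 = 1 := by
    rw [hM_def]
    field_simp
    norm_num
  rw [← mul_assoc (γ ^ 2 / 4) (M ^ 2), h3, one_mul] at h2
  linarith

/-! ### Margin complexity and sign representations -/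

/-- `g` is realized by unit vectors with margin at least `1 / m`, as in the definition of
`mcBool g`. -/
def HasMargin {X Y : Type} (g : X → Y → Bool) (m : ℝ) : Prop :=
  0 < m ∧ ∃ (d : ℕ) (u : X → EuclideanSpace ℝ (Fin d)) (v : Y → EuclideanSpace ℝ (Fin d)),
    (∀ x, ‖u x‖ = 1) ∧ (∀ y, ‖v y‖ = 1) ∧ ∀ x y, 1 / m ≤
      (1 - 2 * (if g x y then (1 : ℝ) else 0)) * inner ℝ (u x) (v y)

theorem mcBool_eq {X Y : Type} (g : X → Y → Bool) : mcBool g = sInf {m | HasMargin g m} := rfl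

/-- The sign vectors `-s · x` and `t · y` of a sign representation with `k` summands, divided by
`√k`, are unit vectors of inner product `-F x y / k`. The minus sign is due to the convention
`J - 2 B`, which turns `true` into `-1`. -/
theorem SignRep.exists_hasMargin {X Y : Type} [Nonempty X] [Nonempty Y] {F : X → Y → ℤ} {l : ℕ}
    {g : X → Y → Bool} (hg : SignRep F g) (hF : HasRep F l) : ∃ m : ℝ, HasMargin g m ∧ m ≤ l := by
  obtain ⟨k, hk, s, t, h⟩ := hF
  have hk0 : 0 < k := by
    rcases Nat.eq_zero_or_pos k with rfl | hk0
    · have := hg (Classical.arbitrary X) (Classical.arbitrary Y)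
      simp [h] at this
    · exact hk0
  have hk0' : (0 : ℝ) < k := by exact_mod_cast hk0
  have hnorm (e : Fin k → ℤˣ) :
      ‖(WithLp.toLp 2 fun i => ((e i : ℤ) : ℝ) / √k : EuclideanSpace ℝ (Fin k))‖ = 1 := by
    rw [← sq_eq_sq₀ (norm_nonneg _) zero_le_one, EuclideanSpace.real_norm_sq_eq]
    have h1 (i) : (((e i : ℤ) : ℝ) / √k) ^ 2 = 1 / k := by
      rw [div_pow, Real.sq_sqrt hk0'.le]
      rcases Int.units_eq_one_or (e i) with h | h <;> simp [h]
    simp only [h1]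
    simp [hk0'.ne']
  refine ⟨k, ⟨hk0', k, fun x => WithLp.toLp 2 fun i => (((-s i x : ℤˣ) : ℤ) : ℝ) / √k,
    fun y => WithLp.toLp 2 fun i => ((t i y : ℤ) : ℝ) / √k, fun x => hnorm fun i => -s i x,
    fun y => hnorm fun i => t i y, fun x y => ?_⟩, Nat.cast_le.2 hk⟩
  have h1 : (1 : ℝ) ≤ ((sgn (g x y) : ℤ) : ℝ) * F x y := by exact_mod_cast hg x y
  have h2 : ∑ i, (((t i y : ℤ) : ℝ) / √k) * ((((-s i x : ℤˣ) : ℤ) : ℝ) / √k) =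
      -(F x y : ℝ) / k := by
    rw [h, Int.cast_sum, ← Finset.sum_neg_distrib, Finset.sum_div]
    refine Finset.sum_congr rfl fun i _ => ?_
    rw [div_mul_div_comm, Real.mul_self_sqrt hk0'.le]
    push_cast
    ring
  simp only [PiLp.inner_apply, RCLike.inner_apply, conj_trivial, h2]
  rw [mul_div_assoc', div_le_div_iff_of_pos_right hk0']
  cases hb : g x y <;> simp [hb, sgn] at h1 ⊢ <;> linarith

theorem mcBool_le {X Y : Type} [Nonempty X] [Nonempty Y] {F : X → Y → ℤ} {l : ℕ} {g : X → Y → Bool}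
    (hF : HasRep F l) (hg : SignRep F g) : mcBool g ≤ l := by
  obtain ⟨m, hm, hml⟩ := hg.exists_hasMargin hF
  rw [mcBool_eq]
  refine le_trans (csInf_le ?_ ?_) hml
  exacts [⟨0, fun m hm => hm.1.le⟩, hm]

theorem nonempty_hasMargin {X Y : Type} [Fintype X] [Nonempty X] [Nonempty Y] (g : X → Y → Bool) :
    {m | HasMargin g m}.Nonempty := by
  obtain ⟨F, l, hF, hg⟩ := exists_signRep g
  obtain ⟨m, hm, -⟩ := hg.exists_hasMargin hF
  exact ⟨m, hm⟩

theorem one_le_mcBool {X Y : Type} [Fintype X] [Nonempty X] [Nonempty Y] (g : X → Y → Bool) :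
    1 ≤ mcBool g := by
  rw [mcBool_eq]
  refine le_csInf (nonempty_hasMargin g) ?_
  rintro m ⟨hm, d, u, v, hu, hv, h⟩
  have h1 := h (Classical.arbitrary X) (Classical.arbitrary Y)
  have h2 := abs_le.1 (abs_real_inner_le_norm (u (Classical.arbitrary X))
    (v (Classical.arbitrary Y)))
  rw [hu, hv, one_mul] at h2
  have h3 : 1 / m ≤ 1 := by
    split_ifs at h1 <;> linarith
  exact (div_le_one hm).1 h3

/-- A Boolean matrix of small margin complexity has a short sign representation: by
`exists_sign_correlation` some rank-one sign matrix is correlated with it under any weighting, so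
the sum of a few of them has the right sign everywhere. -/
theorem exists_signRep_of_mcBool_lt {X Y : Type} [Fintype X] [Fintype Y] [Nonempty X] [Nonempty Y]
    {g : X → Y → Bool} {p : ℕ} (hp : mcBool g < 2 ^ p) {T : ℕ}
    (hT : 16 * Real.log (Fintype.card (X × Y)) < ((1 / 2 ^ p) ^ 3 / 8) ^ 2 * T) :
    ∃ F : X → Y → ℤ, HasRep F T ∧ SignRep F g := by
  obtain ⟨m, ⟨hm, d, u, v, hu, hv, h⟩, hmp⟩ := exists_lt_of_csInf_lt (nonempty_hasMargin g) hp
  set γ : ℝ := 1 / 2 ^ p with hγ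
  have hγ0 : 0 < γ := by positivity
  have hγ1 : γ ≤ 1 := by
    rw [hγ, div_le_one (by positivity)]
    exact one_le_pow₀ one_le_two
  have hv0 : γ ^ 3 / 8 ≤ 1 := by
    have := pow_le_one₀ hγ0.le hγ1 (n := 3)
    linarith
  have hm' : γ ≤ 1 / m := one_div_le_one_div_of_le hm hmp.le
  have hσ (x y) : ((-sgn (g x y) : ℤˣ) : ℤ) = 1 - 2 * (if g x y then (1 : ℤ) else 0) := by
    cases g x y <;> simp [sgn]
  obtain ⟨f, hf⟩ := exists_average_gt (Z := X × Y) (ι := (X → ℤˣ) × (Y → ℤˣ)) (v := γ ^ 3 / 8)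
    (δ := γ ^ 3 / 8)
    (h := fun i z => (((-sgn (g z.1 z.2) : ℤˣ) : ℤ) : ℝ) * ((i.1 z.1 * i.2 z.2 : ℤˣ) : ℤ))
    (fun i z => by
      rw [← Int.cast_mul, ← Units.val_mul]
      rcases Int.units_eq_one_or (-sgn (g z.1 z.2) * (i.1 z.1 * i.2 z.2)) with e | e <;> simp [e])
    (by rwa [abs_of_pos (by positivity)]) (by positivity) hv0
    (fun w hw => by
      obtain ⟨s, t, hst⟩ := exists_sign_correlation hγ0 hu hv (fun x y => -sgn (g x y))
        (fun x y => hm'.trans ((h x y).trans_eq (by rw [hσ]; push_cast; rfl)))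
        (w := fun x y => w (x, y)) fun x y => (hw _).le
      refine ⟨(s, t), ?_⟩
      rw [Fintype.sum_prod_type, Fintype.sum_prod_type]
      exact hst) hT
  refine ⟨_, (HasRep.of_fintype (ι := Fin T) (fun j => (f j).1) (fun j => (f j).2)
    (fun x y => rfl) (by simp)).neg, fun x y => ?_⟩
  have h1 := hf (x, y)
  rw [sub_self, zero_mul, ← Finset.mul_sum] at h1
  rw [mul_neg, ← neg_mul]
  exact_mod_cast h1

/-! ### The perturbed margin complexity -/

section BpPerturb

variable {X Y : Type} [Fintype X] [Fintype Y]

theorem exists_le_bpPerturb {ε : ℝ} (hε : 0 ≤ ε) (Λ : (X → Y → Bool) → ℝ) (f : X → Y → Bool)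
    {μ : X × Y → ℝ} (hμ : μ ∈ stdSimplex ℝ (X × Y)) :
    ∃ g : X → Y → Bool, ∑ p : X × Y with f p.1 p.2 ≠ g p.1 p.2, μ p ≤ ε ∧
      Λ g ≤ bpPerturb ε Λ f := by
  have hne (μ : X × Y → ℝ) : Nonempty {g : X → Y → Bool //
      (∑ p : X × Y with f p.1 p.2 ≠ g p.1 p.2, μ p) ≤ ε} := ⟨f, by simpa using hε⟩
  have := hne μ
  obtain ⟨⟨g, hg⟩, hg'⟩ := exists_eq_ciInf_of_finite (f := fun g : {g : X → Y → Bool //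
      (∑ p : X × Y with f p.1 p.2 ≠ g p.1 p.2, μ p) ≤ ε} => Λ g.1)
  refine ⟨g, hg, hg'.trans_le (le_ciSup (f := fun μ : stdSimplex ℝ (X × Y) =>
    ⨅ g : {g : X → Y → Bool // (∑ p : X × Y with f p.1 p.2 ≠ g p.1 p.2, (μ : X × Y → ℝ) p) ≤ ε},
      Λ g.1) ⟨Λ f, ?_⟩ ⟨μ, hμ⟩)⟩
  rintro _ ⟨ν, rfl⟩
  exact ciInf_le (Set.finite_range _).bddBelow (⟨f, by simpa using hε⟩ : {g : X → Y → Bool //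
      (∑ p : X × Y with f p.1 p.2 ≠ g p.1 p.2, (ν : X × Y → ℝ) p) ≤ ε})

theorem bpPerturb_le [Nonempty X] [Nonempty Y] {ε : ℝ} {Λ : (X → Y → Bool) → ℝ}
    {f : X → Y → Bool} {c : ℝ} (h : ∀ μ ∈ stdSimplex ℝ (X × Y), ∃ g : X → Y → Bool,
      ∑ p : X × Y with f p.1 p.2 ≠ g p.1 p.2, μ p ≤ ε ∧ Λ g ≤ c) :
    bpPerturb ε Λ f ≤ c := by
  classical
  have : Nonempty (stdSimplex ℝ (X × Y)) :=
    ⟨⟨_, single_mem_stdSimplex ℝ (Classical.arbitrary (X × Y))⟩⟩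
  refine ciSup_le fun μ => ?_
  obtain ⟨g, hg, hc⟩ := h μ μ.2
  exact (ciInf_le (Set.finite_range _).bddBelow (⟨g, hg⟩ : {g : X → Y → Bool //
      (∑ p : X × Y with f p.1 p.2 ≠ g p.1 p.2, (μ : X × Y → ℝ) p) ≤ ε})).trans hc

theorem one_le_bpPerturb [Nonempty X] [Nonempty Y] (f : X → Y → Bool) :
    1 ≤ bpPerturb (1 / 3) mcBool f := by
  classical
  obtain ⟨g, -, hg⟩ := exists_le_bpPerturb (ε := 1 / 3) (by norm_num) mcBool f
    (single_mem_stdSimplex ℝ (Classical.arbitrary (X × Y)))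
  exact (one_le_mcBool g).trans hg

theorem exists_weighted_agreement [Nonempty X] [Nonempty Y] (f : X → Y → Bool)
    {w : X × Y → ℝ} (hw : ∀ z, 0 < w z) :
    ∃ g : X → Y → Bool, mcBool g ≤ bpPerturb (1 / 3) mcBool f ∧
      2 / 3 * ∑ z, w z ≤ ∑ z, w z * (if f z.1 z.2 = g z.1 z.2 then 1 else 0) := by
  have hW : 0 < ∑ z, w z := Finset.sum_pos (fun z _ => hw z) Finset.univ_nonempty
  obtain ⟨g, hg, hg'⟩ := exists_le_bpPerturb (by norm_num) mcBool f
    (μ := fun z => w z / ∑ z, w z) (ε := 1 / 3)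
    ⟨fun z => div_nonneg (hw z).le hW.le, by rw [← Finset.sum_div, div_self hW.ne']⟩
  refine ⟨g, hg', ?_⟩
  rw [← Finset.sum_div, div_le_iff₀ hW] at hg
  have := Finset.sum_filter_add_sum_filter_not Finset.univ
    (fun z : X × Y => f z.1 z.2 = g z.1 z.2) w
  simp only [mul_ite, mul_one, mul_zero, ← Finset.sum_filter]
  linarith

end BpPerturb

/-! ### Majority voting among three random approximations -/

theorem maj_ne_eq (a b c z : Bool) : (if maj a b c ≠ z then (1 : ℝ) else 0) =
    (if a ≠ z then 1 else 0) * (if b ≠ z then 1 else 0) +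
    (if a ≠ z then 1 else 0) * (if c ≠ z then 1 else 0) +
    (if b ≠ z then 1 else 0) * (if c ≠ z then 1 else 0) -
    2 * ((if a ≠ z then 1 else 0) * (if b ≠ z then 1 else 0) * (if c ≠ z then 1 else 0)) := by
  cases a <;> cases b <;> cases c <;> cases z <;> norm_num [maj]

/-- If a fraction `e ≤ 1 / 3 + 1 / 25` of the votes is wrong, then the majority of three independent
votes is wrong with probability `3 * e ^ 2 - 2 * e ^ 3 ≤ 1 / 3`. -/
theorem card_maj_ne_le {ι : Type*} [Fintype ι] {v : ι → Bool} {z : Bool}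
    (h : (2 / 3 - 1 / 25) * (Fintype.card ι : ℝ) ≤ ∑ i, if z = v i then 1 else 0) :
    3 * (Finset.univ.filter fun i : ι × ι × ι => maj (v i.1) (v i.2.1) (v i.2.2) ≠ z).card ≤
      Fintype.card ι ^ 3 := by
  have key : ((Finset.univ.filter fun i : ι × ι × ι =>
      maj (v i.1) (v i.2.1) (v i.2.2) ≠ z).card : ℝ) =
      3 * (∑ i, if v i ≠ z then (1 : ℝ) else 0) ^ 2 * Fintype.card ι -
        2 * (∑ i, if v i ≠ z then (1 : ℝ) else 0) ^ 3 := by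
    simp only [Finset.card_filter, Nat.cast_sum, Nat.cast_ite, Nat.cast_one, Nat.cast_zero,
      maj_ne_eq, Fintype.sum_prod_type, Finset.sum_add_distrib, Finset.sum_sub_distrib,
      ← Finset.mul_sum, ← Finset.sum_mul, Finset.sum_const, Finset.card_univ, nsmul_eq_mul]
    ring
  have hsum : (∑ i, if v i ≠ z then (1 : ℝ) else 0) + (∑ i, if z = v i then (1 : ℝ) else 0) =
      Fintype.card ι := by
    rw [← Finset.sum_add_distrib, Fintype.card_eq_sum_ones, Nat.cast_sum]
    refine Finset.sum_congr rfl fun i _ => ?_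
    rcases eq_or_ne z (v i) with hz | hz
    · simp [hz]
    · simp [hz, hz.symm]
  have hb : 0 ≤ ∑ i, if v i ≠ z then (1 : ℝ) else 0 :=
    Finset.sum_nonneg fun i _ => by split_ifs <;> norm_num
  have : (3 : ℝ) * (Finset.univ.filter fun i : ι × ι × ι =>
      maj (v i.1) (v i.2.1) (v i.2.2) ≠ z).card ≤ (Fintype.card ι : ℝ) ^ 3 := by
    rw [key]
    -- `28 / 75 = 1 / 3 + 1 / 25`, and `b ^ 2 * (9 * t - 6 * b)` increases with `b` on `[0, t]`.
    generalize (∑ i, if v i ≠ z then (1 : ℝ) else 0) = b at *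
    generalize (∑ i, if z = v i then (1 : ℝ) else 0) = a at *
    generalize (Fintype.card ι : ℝ) = t at *
    have hbt : b ≤ 28 / 75 * t := by linarith
    have ht : 0 ≤ t := by linarith
    have h1 : 0 ≤ (28 / 75 * t - b) * (9 * t * (28 / 75 * t + b) -
        6 * ((28 / 75 * t) ^ 2 + 28 / 75 * t * b + b ^ 2)) := by
      refine mul_nonneg (by linarith) ?_
      have : b ^ 2 ≤ t * b := by nlinarith
      nlinarith [mul_nonneg ht hb, sq_nonneg t]
    have : 0 ≤ t ^ 3 := by positivity
    nlinarith
  exact_mod_cast this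

theorem card_word (n : ℕ) : Fintype.card (Word n) = 2 ^ n := by simp

theorem log_card_word_prod_word (n : ℕ) :
    Real.log (Fintype.card (Word n × Word n)) = 2 * n * Real.log 2 := by
  rw [Fintype.card_prod, card_word]
  push_cast
  rw [← pow_add, Real.log_pow]
  push_cast
  ring

/-- The number of random bits used for an `n`-bit section: they encode three indices of samples,
out of `2 ^ (14 + ⌈log n⌉)`. -/
def randLen (n : ℕ) : ℕ := 3 * (14 + Nat.clog 2 n)

/-- The logarithm of a number of summands that suffices for a sign representation of a matrix of
size `2 ^ n` and margin complexity less than `2 ^ p`, by `exists_signRep_of_mcBool_lt`. -/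
def repLen (n p : ℕ) : ℕ := 6 * p + 11 + Nat.clog 2 n

/-- A Boolean matrix whose perturbed margin complexity is small agrees everywhere with
probability at least `2 / 3` with a random matrix that has a short sign representation. The random
matrix is the majority of three independent samples from a short list, of which at each entry a
fraction of more than `2 / 3 - 1 / 25` is right. -/
theorem exists_random_signRep {n : ℕ} (hn : 1 ≤ n) (f : Word n → Word n → Bool) {p : ℕ}
    (hp : bpPerturb (1 / 3) mcBool f < 2 ^ p) :
    ∃ (g : Word (randLen n) → Word n → Word n → Bool) (F : Word (randLen n) → Word n → Word n → ℤ),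
      (∀ r, HasRep (F r) (2 ^ (6 * (repLen n p + 1) ^ 2 + 5)) ∧ SignRep (F r) (g r)) ∧
      ∀ x y, 3 * (Finset.univ.filter fun r => g r x y ≠ f x y).card ≤ 2 ^ randLen n := by
  have hn' : (n : ℝ) ≤ 2 ^ Nat.clog 2 n := by exact_mod_cast Nat.le_pow_clog one_lt_two n
  have hn1 : (1 : ℝ) ≤ n := by exact_mod_cast hn
  have hlog := Real.log_two_lt_d9
  set T := 2 ^ (14 + Nat.clog 2 n) with hT
  obtain ⟨G, hG⟩ := exists_average_gt (Z := Word n × Word n)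
    (ι := {g : Word n → Word n → Bool // mcBool g ≤ bpPerturb (1 / 3) mcBool f})
    (h := fun g z => if f z.1 z.2 = g.1 z.1 z.2 then (1 : ℝ) else 0) (v := 2 / 3) (δ := 1 / 25)
    (T := T) (fun g z => by split_ifs <;> norm_num) (by norm_num [abs_of_pos]) (by norm_num)
    (by norm_num)
    (fun w hw => by
      obtain ⟨g, hg, hg'⟩ := exists_weighted_agreement f hw
      exact ⟨⟨g, hg⟩, hg'⟩)
    (by
      rw [log_card_word_prod_word, hT]
      push_cast
      rw [pow_add]
      nlinarith)
  have hrep (i : Fin T) : ∃ F : Word n → Word n → ℤ, HasRep F (2 ^ repLen n p) ∧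
      SignRep F (G i).1 := by
    refine exists_signRep_of_mcBool_lt ((G i).2.trans_lt hp) ?_
    rw [log_card_word_prod_word, repLen]
    have : ((1 / (2 : ℝ) ^ p) ^ 3 / 8) ^ 2 * ((2 ^ (6 * p + 11 + Nat.clog 2 n) : ℕ) : ℝ) =
        32 * 2 ^ Nat.clog 2 n := by
      push_cast
      rw [pow_add, pow_add, pow_mul']
      field_simp
      norm_num
    rw [this]
    nlinarith
  choose F hF hFG using hrep
  have hmaj (i : Fin T × Fin T × Fin T) := exists_signRep_maj (K := repLen n p)
    (F := ![F i.1, F i.2.1, F i.2.2]) (g := ![(G i.1).1, (G i.2.1).1, (G i.2.2).1])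
    (by simp [Fin.forall_fin_succ, hF]) (by simp [Fin.forall_fin_succ, hFG])
  choose H hH hHG using hmaj
  have hcard : Fintype.card (Word (randLen n)) = Fintype.card (Fin T × Fin T × Fin T) := by
    rw [card_word]
    simp only [Fintype.card_prod, Fintype.card_fin, hT, randLen]
    ring
  let e := Fintype.equivOfCardEq hcard
  refine ⟨fun r x y => maj ((G (e r).1).1 x y) ((G (e r).2.1).1 x y) ((G (e r).2.2).1 x y),
    fun r => H (e r), fun r => ⟨hH _, hHG _⟩, fun x y => ?_⟩
  have h1 := card_maj_ne_le (v := fun i : Fin T => (G i).1 x y) (z := f x y) (by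
    simpa using (hG (x, y)).le)
  have h2 : Fintype.card (Fin T) ^ 3 = 2 ^ randLen n := by
    rw [Fintype.card_fin, hT, randLen, ← pow_mul, mul_comm]
  rw [← h2]
  refine le_trans (le_of_eq ?_) h1
  congr 1
  exact Finset.card_equiv e (by simp)

/-! ### Polylogarithmic bounds -/

namespace IsPolylog

variable {f g : ℕ → ℝ}

theorem mono (hg : IsPolylog g) (h : ∀ n, 1 ≤ n → f n ≤ g n) : IsPolylog f := by
  obtain ⟨p, hp⟩ := hg
  exact ⟨p, fun n hn => (h n hn).trans (hp n hn)⟩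

theorem const (c : ℝ) : IsPolylog fun _ => c := ⟨.C c, by simp⟩

theorem logb : IsPolylog fun n => Real.logb 2 n := ⟨.X, by simp⟩

theorem add (hf : IsPolylog f) (hg : IsPolylog g) : IsPolylog fun n => f n + g n := by
  obtain ⟨p, hp⟩ := hf
  obtain ⟨q, hq⟩ := hg
  exact ⟨p + q, fun n hn => by simpa using add_le_add (hp n hn) (hq n hn)⟩

theorem mul (hf : IsPolylog f) (hg : IsPolylog g) (hf0 : ∀ n, 1 ≤ n → 0 ≤ f n)
    (hg0 : ∀ n, 1 ≤ n → 0 ≤ g n) : IsPolylog fun n => f n * g n := by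
  obtain ⟨p, hp⟩ := hf
  obtain ⟨q, hq⟩ := hg
  exact ⟨p * q, fun n hn => by
    simpa using mul_le_mul (hp n hn) (hq n hn) (hg0 n hn) ((hf0 n hn).trans (hp n hn))⟩

theorem pow (hf : IsPolylog f) (hf0 : ∀ n, 1 ≤ n → 0 ≤ f n) (k : ℕ) :
    IsPolylog fun n => f n ^ k := by
  induction k with
  | zero => simpa using const 1
  | succ k ih =>
    simp only [pow_succ]
    exact ih.mul hf (fun n hn => pow_nonneg (hf0 n hn) k) hf0

theorem natCeil (hf : IsPolylog f) (hf0 : ∀ n, 1 ≤ n → 0 ≤ f n) :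
    IsPolylog fun n => (⌈f n⌉₊ : ℝ) :=
  (hf.add (const 1)).mono fun n hn => (Nat.ceil_lt_add_one (hf0 n hn)).le

end IsPolylog

theorem logb_natCast_nonneg (n : ℕ) : 0 ≤ Real.logb 2 n :=
  div_nonneg (Real.log_natCast_nonneg n) (Real.log_nonneg one_le_two)

theorem natCeil_logb_two (n : ℕ) : ⌈Real.logb 2 n⌉₊ = Nat.clog 2 n := by
  simpa using Real.natCeil_logb_natCast 2 n

theorem IsPolylog.clog : IsPolylog fun n => (Nat.clog 2 n : ℝ) :=
  (IsPolylog.logb.natCeil fun n _ => logb_natCast_nonneg n).mono fun n _ => by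
    rw [natCeil_logb_two]

theorem exists_eval_le_pow (p : Polynomial ℝ) :
    ∃ k : ℕ, ∀ t : ℝ, 0 ≤ t → p.eval t ≤ (2 + t) ^ k := by
  induction p using Polynomial.induction_on' with
  | add p q hp hq =>
    obtain ⟨k, hk⟩ := hp
    obtain ⟨l, hl⟩ := hq
    refine ⟨max k l + 1, fun t ht => ?_⟩
    have h1 : (1 : ℝ) ≤ 2 + t := by linarith
    have h2 : (2 + t) ^ k ≤ (2 + t) ^ max k l := pow_le_pow_right₀ h1 (le_max_left _ _)
    have h3 : (2 + t) ^ l ≤ (2 + t) ^ max k l := pow_le_pow_right₀ h1 (le_max_right _ _)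
    have h4 : 0 ≤ (2 + t) ^ max k l := by positivity
    rw [Polynomial.eval_add, pow_succ]
    nlinarith [hk t ht, hl t ht]
  | monomial n a =>
    obtain ⟨j, hj⟩ := pow_unbounded_of_one_lt a (one_lt_two (α := ℝ))
    refine ⟨j + n, fun t ht => ?_⟩
    rw [Polynomial.eval_monomial, pow_add]
    refine mul_le_mul (hj.le.trans (pow_le_pow_left₀ zero_le_two (by linarith) j))
      (pow_le_pow_left₀ ht (by linarith) n) (by positivity) (by positivity)

theorem IsPolylog.exists_pow {f : ℕ → ℝ} (hf : IsPolylog f) :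
    ∃ k : ℕ, ∀ n, 1 ≤ n → f n ≤ (2 + Real.logb 2 n) ^ k := by
  obtain ⟨p, hp⟩ := hf
  obtain ⟨k, hk⟩ := exists_eval_le_pow p
  exact ⟨k, fun n hn => (hp n hn).trans (hk _ (logb_natCast_nonneg n))⟩

theorem IsPolylog.of_pow {f : ℕ → ℝ} {k : ℕ}
    (hf : ∀ n, 1 ≤ n → f n ≤ (2 + Real.logb 2 n) ^ k) : IsPolylog f :=
  ⟨(2 + .X) ^ k, by simpa using hf⟩

theorem IsPolylog.comp {f : ℕ → ℝ} (hf : IsPolylog f) {N : ℕ → ℕ} (hN : ∀ n, 1 ≤ n → 1 ≤ N n)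
    (h : IsPolylog fun n => Real.logb 2 (N n)) : IsPolylog fun n => f (N n) := by
  obtain ⟨k, hk⟩ := hf.exists_pow
  exact (((IsPolylog.const 2).add h).pow (fun n _ => by
    have := logb_natCast_nonneg (N n)
    positivity) k).mono fun n hn => hk _ (hN n hn)

/-- The length of the pairs `⟨x, r⟩` of strings of lengths `n` and `m`. -/
abbrev pairLen (n m : ℕ) : ℕ := n + (1 + (n + m))

theorem isPolylog_logb_pairLen {m : ℕ → ℕ} (hm : IsPolylog fun n => (m n : ℝ)) :
    IsPolylog fun n => Real.logb 2 (pairLen n (m n)) := by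
  refine (((IsPolylog.const 2).add .logb).add hm).mono fun n hn => ?_
  have h1 : pairLen n (m n) ≤ 2 ^ 2 * n * 2 ^ m n := by
    have : m n + 1 ≤ 2 ^ m n := Nat.lt_two_pow_self
    unfold pairLen
    nlinarith
  have h2 : (0 : ℝ) < pairLen n (m n) := by
    rw [Nat.cast_pos, pairLen]
    omega
  have h3 : (n : ℝ) ≠ 0 := by
    have : n ≠ 0 := by omega
    exact_mod_cast this
  calc Real.logb 2 (pairLen n (m n)) ≤ Real.logb 2 (2 ^ 2 * n * 2 ^ m n) :=
        Real.logb_le_logb_of_le one_lt_two h2 (by exact_mod_cast h1)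
    _ = _ := by
        rw [Real.logb_mul (by positivity) (by positivity), Real.logb_mul (by positivity) h3,
          Real.logb_pow, Real.logb_pow, Real.logb_self_eq_one one_lt_two]
        simp

theorem isPolylog_natCeil_of_polyBounded {q : ℝ → ℝ} (hq : PolyBounded q) :
    IsPolylog fun n => (⌈q (Real.logb 2 n)⌉₊ : ℝ) := by
  obtain ⟨p, hp⟩ := hq
  exact IsPolylog.natCeil ⟨p, fun n _ => (hp _ (logb_natCast_nonneg n)).2⟩
    fun n _ => (hp _ (logb_natCast_nonneg n)).1

/-! ### The bounded-error condition -/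

theorem nSection_eq_true {L : CommLanguage} {n : ℕ} {x y : Word n} :
    nSection L n x y = true ↔ (⟨n, x, y⟩ : WordPair) ∈ L := by
  simp [nSection]

theorem nSection_eq_false {L : CommLanguage} {n : ℕ} {x y : Word n} :
    nSection L n x y = false ↔ (⟨n, x, y⟩ : WordPair) ∉ L := by
  simp [nSection]

theorem acceptFraction_eq (L' : CommLanguage) {n m : ℕ} (x y : Word n) :
    acceptFraction L' m x y = ((Finset.univ.filter fun r : Word m =>
      nSection L' (pairLen n m) (pair x r) (pair y r) = true).card : ℝ) / 2 ^ m := by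
  rw [acceptFraction, ← Set.ncard_coe_finset]
  congr 3
  ext r
  rw [Finset.mem_coe, Finset.mem_filter, nSection_eq_true]
  simp

theorem card_filter_eq_add_card_filter_ne {m : ℕ} (g : Word m → Bool) :
    (Finset.univ.filter fun r => g r = true).card + (Finset.univ.filter fun r => g r ≠ true).card =
      2 ^ m := by
  rw [Finset.card_filter_add_card_filter_not, Finset.card_univ, card_word]

/-- The condition in the definition of `BPop` says that at most one third of the random strings
give the wrong answer. -/
theorem acceptFraction_iff {L L' : CommLanguage} {n m : ℕ} {x y : Word n} :
    (((⟨n, x, y⟩ : WordPair) ∉ L → acceptFraction L' m x y ≤ 1 / 3) ∧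
      ((⟨n, x, y⟩ : WordPair) ∈ L → 2 / 3 ≤ acceptFraction L' m x y)) ↔
    3 * (Finset.univ.filter fun r : Word m =>
      nSection L' (pairLen n m) (pair x r) (pair y r) ≠ nSection L n x y).card ≤ 2 ^ m := by
  have h := card_filter_eq_add_card_filter_ne fun r : Word m =>
    nSection L' (pairLen n m) (pair x r) (pair y r)
  have h2 : (0 : ℝ) < 2 ^ m := by positivity
  rw [acceptFraction_eq]
  by_cases hL : (⟨n, x, y⟩ : WordPair) ∈ L
  · simp only [hL, not_true_eq_false, false_imp_iff, true_imp_iff, true_and,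
      nSection_eq_true.2 hL]
    rw [div_le_div_iff₀ (by norm_num) h2]
    have : (2 : ℝ) * 2 ^ m ≤ (Finset.univ.filter fun r : Word m =>
      nSection L' (pairLen n m) (pair x r) (pair y r) = true).card * 3 ↔ 2 * 2 ^ m ≤
        (Finset.univ.filter fun r : Word m =>
      nSection L' (pairLen n m) (pair x r) (pair y r) = true).card * 3 := by exact_mod_cast Iff.rfl
    rw [this]
    omega
  · simp only [hL, not_false_eq_true, false_imp_iff, true_imp_iff, and_true,
      nSection_eq_false.2 hL, Bool.not_eq_false, ne_eq]
    rw [div_le_div_iff₀ h2 (by norm_num)]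
    norm_cast
    rw [one_mul, mul_comm]

/-! ### From low margin rigidity to bounded-error PP -/

/-- The substring of length `l` of `z` that starts at position `a`, padded if `z` is too short. -/
def slice {N : ℕ} (a l : ℕ) (z : Word N) : Word l :=
  fun i => if h : a + i < N then z ⟨a + i, h⟩ else false

theorem slice_pair_left {n m : ℕ} (x : Word n) (r : Word m) : slice (n + 1) n (pair x r) = x := by
  ext i
  have h1 : n + 1 + i < n + (1 + (n + m)) := by omega
  have h2 : (⟨n + 1 + i, h1⟩ : Fin (n + (1 + (n + m)))) =
      Fin.natAdd n (Fin.natAdd 1 (Fin.castAdd m i)) := by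
    ext
    simp
    omega
  rw [slice, dif_pos h1, h2, pair, Fin.append_right, Fin.append_right, Fin.append_left]

theorem slice_pair_right {n m : ℕ} (x : Word n) (r : Word m) :
    slice (n + 1 + n) m (pair x r) = r := by
  ext i
  have h1 : n + 1 + n + i < n + (1 + (n + m)) := by omega
  have h2 : (⟨n + 1 + n + i, h1⟩ : Fin (n + (1 + (n + m)))) =
      Fin.natAdd n (Fin.natAdd 1 (Fin.natAdd n i)) := by
    ext
    simp
    omega
  rw [slice, dif_pos h1, h2, pair, Fin.append_right, Fin.append_right, Fin.append_right]

theorem randLen_mono : Monotone randLen := fun _ _ h =>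
  Nat.mul_le_mul_left _ (Nat.add_le_add_left (Nat.clog_mono_right _ h) _)

theorem pairLen_randLen_injective : Function.Injective fun n => pairLen n (randLen n) :=
  StrictMono.injective fun a b h => by
    have := randLen_mono h.le
    simp only [pairLen]
    omega

/-- The random approximations of the sections of `L` given by `exists_random_signRep` are the
sections, for the various random strings `r`, of one language. As `n` can be recovered from the
length of `⟨x, r⟩`, and Alice can read off `r` from her own input, that language is in `PPcc`. -/
theorem Mcc_subset : Mcc ⊆ BPop PPcc := by
  intro L hL
  set B : ℕ → ℝ := fun n => bpPerturb (1 / 3) mcBool (nSection L n) with hB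
  have hB1 (n) : 1 ≤ B n := one_le_bpPerturb _
  set p : ℕ → ℕ := fun n => ⌈Real.logb 2 (B n)⌉₊ + 1 with hp_def
  have hp (n) : B n < 2 ^ p n := by
    have hlog : Real.logb 2 (B n) < p n := (Nat.le_ceil _).trans_lt (by simp [hp_def])
    rw [Real.logb_lt_iff_lt_rpow one_lt_two (by linarith [hB1 n])] at hlog
    exact_mod_cast hlog
  have hp_polylog : IsPolylog fun n => (p n : ℝ) := by
    have h : IsPolylog fun n => Real.logb 2 (B n) := hL
    simpa [hp_def] using
      (h.natCeil fun n _ => Real.logb_nonneg one_lt_two (hB1 n)).add (.const 1)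
  choose g F hF hg using fun n (hn : 1 ≤ n) => exists_random_signRep hn (nSection L n) (hp n)
  let L' : CommLanguage := {w | ∃ n, ∃ hn : 1 ≤ n, w.1 = pairLen n (randLen n) ∧
    0 < F n hn (slice (n + 1 + n) (randLen n) w.2.1) (slice (n + 1) n w.2.1)
      (slice (n + 1) n w.2.2)}
  have hL'_iff (n) (hn : 1 ≤ n) (x y : Word (pairLen n (randLen n))) :
      nSection L' _ x y = true ↔ 0 < F n hn (slice (n + 1 + n) (randLen n) x)
        (slice (n + 1) n x) (slice (n + 1) n y) := by
    rw [nSection_eq_true]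
    constructor
    · rintro ⟨n', hn', h, h'⟩
      obtain rfl : n = n' := pairLen_randLen_injective h
      exact h'
    · exact fun h => ⟨n, hn, rfl, h⟩
  refine ⟨L', ?_, fun t => 3 * (14 + ⌈t⌉₊), ⟨3 * (15 + .X), fun t ht => ⟨by positivity, ?_⟩⟩,
    fun n hn x y => ?_⟩
  · set b : ℕ → ℕ := fun n => randLen n + 6 * (repLen n (p n) + 1) ^ 2 + 8 with hb_def
    have hb : IsPolylog fun n => (b n : ℝ) := by
      have h1 : IsPolylog fun n => (randLen n : ℝ) := by
        simpa [randLen] using (IsPolylog.const 3).mul ((IsPolylog.const 14).add .clog)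
          (by simp) (fun n _ => by positivity)
      have h2 : IsPolylog fun n => ((repLen n (p n) + 1 : ℕ) : ℝ) := by
        simpa [repLen] using (((((IsPolylog.const 6).mul hp_polylog (by simp) (by simp)).add
          (.const 11)).add .clog).add (.const 1))
      simpa [hb_def] using (h1.add ((IsPolylog.const 6).mul (h2.pow (fun n _ => by positivity) 2)
        (by simp) (fun n _ => by positivity))).add (.const 8)
    obtain ⟨k, hk⟩ := hb.exists_pow
    refine IsPolylog.of_pow (k := k) fun N hN => ?_
    have hlogN := logb_natCast_nonneg N
    by_cases h : ∃ n, 1 ≤ n ∧ N = pairLen n (randLen n)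
    · obtain ⟨n, hn, rfl⟩ := h
      have hle : n ≤ pairLen n (randLen n) := Nat.le_add_right _ _
      have hrep := HasRep.select (fun r => ((hF n hn r).1.comap
        (slice (N := pairLen n (randLen n)) (n + 1) n)
        (slice (N := pairLen n (randLen n)) (n + 1) n))) (slice (n + 1 + n) (randLen n))
      have hpp := ppComplexity_le hrep (f := nSection L' (pairLen n (randLen n))) fun x y => by
        rw [hL'_iff n hn]
        omega
      rw [card_word, ← pow_succ', ← pow_add, Nat.clog_pow _ _ one_lt_two] at hpp
      have hpp' : ppComplexity (nSection L' (pairLen n (randLen n))) ≤ b n := by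
        rw [hb_def]
        omega
      calc (ppComplexity (nSection L' (pairLen n (randLen n))) : ℝ) ≤ b n := by exact_mod_cast hpp'
        _ ≤ (2 + Real.logb 2 n) ^ k := hk n hn
        _ ≤ _ := by
          have h1 := logb_natCast_nonneg n
          have h2 := Real.logb_le_logb_of_le one_lt_two
            (by exact_mod_cast hn : (0 : ℝ) < n) (Nat.cast_le.2 hle)
          exact pow_le_pow_left₀ (by positivity) (by linarith) k
    · have h0 : ppComplexity (nSection L' N) = 0 := by
        refine ppComplexity_eq_zero fun x y => ?_
        rw [nSection_eq_false]
        rintro ⟨n, hn, hN, -⟩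
        exact h ⟨n, hn, hN⟩
      rw [h0, Nat.cast_zero]
      positivity
  · have := (Nat.ceil_lt_add_one ht).le
    simp only [Polynomial.eval_mul, Polynomial.eval_add, Polynomial.eval_ofNat, Polynomial.eval_X]
    linarith
  · -- With `q t = 3 * (14 + ⌈t⌉)` the number of random bits is exactly `randLen n`.
    have hq : ⌈(3 * (14 + ⌈Real.logb 2 n⌉₊) : ℝ)⌉₊ = randLen n := by
      rw [natCeil_logb_two, randLen]
      exact_mod_cast Nat.ceil_natCast (R := ℝ) (3 * (14 + Nat.clog 2 n))
    rw [hq, acceptFraction_iff]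
    refine le_trans (Nat.mul_le_mul_left 3 (le_of_eq ?_)) (hg n hn x y)
    congr 2
    ext r
    have : nSection L' (pairLen n (randLen n)) (pair x r) (pair y r) = g n hn r x y := by
      rw [Bool.eq_iff_iff, hL'_iff n hn, slice_pair_left, slice_pair_left, slice_pair_right]
      exact ((hF n hn r).2.pos_iff x y).symm
    rw [this]

/-! ### From bounded-error PP to low margin rigidity -/

/-- If `f` agrees with a random matrix with probability at least `2 / 3` at every entry, then
for every distribution of the entries some value of the random matrix is close to `f`. -/
theorem exists_sum_ne_le {X Y R : Type} [Fintype X] [Fintype Y] [Fintype R] [Nonempty R]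
    {f : X → Y → Bool} {g : R → X → Y → Bool}
    (h : ∀ x y, 3 * (Finset.univ.filter fun r => g r x y ≠ f x y).card ≤ Fintype.card R)
    {μ : X × Y → ℝ} (hμ : μ ∈ stdSimplex ℝ (X × Y)) :
    ∃ r, ∑ p : X × Y with f p.1 p.2 ≠ g r p.1 p.2, μ p ≤ 1 / 3 := by
  obtain ⟨r, -, hr⟩ : ∃ r ∈ (Finset.univ : Finset R),
      ∑ p : X × Y with f p.1 p.2 ≠ g r p.1 p.2, μ p ≤ 1 / 3 := by
    refine Finset.exists_le_of_sum_le Finset.univ_nonempty ?_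
    simp only [Finset.sum_filter]
    rw [Finset.sum_comm]
    have hp (p : X × Y) : ∑ r, (if f p.1 p.2 ≠ g r p.1 p.2 then μ p else 0) ≤
        μ p * (Fintype.card R / 3) := by
      rw [← Finset.sum_filter, Finset.sum_const, nsmul_eq_mul, mul_comm]
      refine mul_le_mul_of_nonneg_left ?_ (hμ.1 p)
      have := h p.1 p.2
      simp only [ne_comm (b := f p.1 p.2)] at this
      rw [le_div_iff₀ (by norm_num), mul_comm]
      exact_mod_cast this
    refine (Finset.sum_le_sum fun p _ => hp p).trans ?_
    rw [← Finset.sum_mul, hμ.2, Finset.sum_const, Finset.card_univ, nsmul_eq_mul]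
    linarith
  exact ⟨r, hr⟩

theorem isPolylog_ppComplexity_pairLen {L' : CommLanguage} (hL' : L' ∈ PPcc) {m : ℕ → ℕ}
    (hm : IsPolylog fun n => (m n : ℝ)) :
    IsPolylog fun n => (ppComplexity (nSection L' (pairLen n (m n))) : ℝ) :=
  IsPolylog.comp (f := fun N => (ppComplexity (nSection L' N) : ℝ)) hL'
    (fun n hn => by rw [pairLen]; omega) (isPolylog_logb_pairLen hm)

theorem BPop_PPcc_subset_Mcc : BPop PPcc ⊆ Mcc := by
  rintro L ⟨L', hL', q, hq, h⟩
  simp only [acceptFraction_iff] at h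
  set m : ℕ → ℕ := fun n => ⌈q (Real.logb 2 n)⌉₊ with hm_def
  have hm : IsPolylog fun n => (m n : ℝ) := isPolylog_natCeil_of_polyBounded hq
  set c : ℕ → ℕ := fun n => ppComplexity (nSection L' (pairLen n (m n))) with hc_def
  have hc : IsPolylog fun n => (c n : ℝ) := isPolylog_ppComplexity_pairLen hL' hm
  refine ((IsPolylog.const 2).mul (hc.add (.const 1)) (by simp)
    (fun n _ => by positivity)).mono fun n hn => ?_
  have hle : bpPerturb (1 / 3) mcBool (nSection L n) ≤ 4 ^ (c n + 1) := by
    refine bpPerturb_le fun μ hμ => ?_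
    obtain ⟨r, hr⟩ := exists_sum_ne_le (R := Word (m n))
      (g := fun r x y => nSection L' (pairLen n (m n)) (pair x r) (pair y r))
      (fun x y => by rw [card_word]; exact h n hn x y) hμ
    refine ⟨fun x y => nSection L' (pairLen n (m n)) (pair x r) (pair y r), hr, ?_⟩
    obtain ⟨F, hF, hFf⟩ := exists_hasRep_ppComplexity (nSection L' (pairLen n (m n)))
    -- `0 < F` is the sign of the odd number `2 * F - 1`.
    have hrep := ((((HasRep.natCast 2).mul hF).sub (HasRep.natCast 1)).comap
      (fun x : Word n => pair x r) (fun y : Word n => pair y r)).mono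
      (l' := 4 ^ (c n + 1)) (by
        have : 1 ≤ 4 ^ c n := Nat.one_le_pow _ _ (by norm_num)
        rw [pow_succ]
        simp only [hc_def] at this ⊢
        omega)
    have := mcBool_le (g := fun x y => nSection L' (pairLen n (m n)) (pair x r) (pair y r)) hrep
      fun x y => by
        have := hFf (pair x r) (pair y r)
        cases hb : nSection L' (pairLen n (m n)) (pair x r) (pair y r) <;>
          simp [sgn, hb] at this ⊢ <;> omega
    exact_mod_cast this
  have h1 : (4 : ℝ) ^ (c n + 1) = 2 ^ (2 * (c n + 1)) := by
    rw [pow_mul]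
    norm_num
  refine (Real.logb_le_logb_of_le one_lt_two (by linarith [one_le_bpPerturb (nSection L n)])
    hle).trans (le_of_eq ?_)
  rw [h1, Real.logb_pow, Real.logb_self_eq_one one_lt_two]
  push_cast
  ring

/-! ### Alternating quantifiers -/

/-- `Alt b ls P`: the predicate `P` on pairs `(x, y)` can be written with alternating quantifiers
over strings of lengths `ls`, the first one existential if and only if `b` is true, in front of a
conjunction of a predicate of `x` and a predicate of `y`. -/
def Alt {X Y : Type} : Bool → List ℕ → (X → Y → Prop) → Prop
  | _, [], P => ∃ (a : X → Prop) (b : Y → Prop), ∀ x y, P x y ↔ a x ∧ b y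
  | true, l :: ls, P => ∃ Q : Word l → X → Y → Prop, (∀ u, Alt false ls (Q u)) ∧
      ∀ x y, P x y ↔ ∃ u, Q u x y
  | false, l :: ls, P => ∃ Q : Word l → X → Y → Prop, (∀ u, Alt true ls (Q u)) ∧
      ∀ x y, P x y ↔ ∀ u, Q u x y

namespace Alt

variable {X Y : Type}

theorem congr {P P' : X → Y → Prop} {b : Bool} {ls : List ℕ} (h : Alt b ls P)
    (hP : ∀ x y, P' x y ↔ P x y) : Alt b ls P' := by
  obtain rfl : P' = P := by
    ext x y
    exact hP x y
  exact h

theorem const (b : Bool) (ls : List ℕ) (p : Prop) : Alt b ls fun (_ : X) (_ : Y) => p := by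
  induction ls generalizing b with
  | nil => exact ⟨fun _ => p, fun _ => p, by simp⟩
  | cons l ls ih => cases b <;> exact ⟨fun _ _ _ => p, fun _ => ih _, by simp⟩

theorem comap {X' Y' : Type} {P : X → Y → Prop} {b : Bool} {ls : List ℕ} (h : Alt b ls P)
    (α : X' → X) (β : Y' → Y) : Alt b ls fun x y => P (α x) (β y) := by
  induction ls generalizing b P with
  | nil =>
    obtain ⟨a, b, h⟩ := h
    exact ⟨fun x => a (α x), fun y => b (β y), fun x y => h _ _⟩
  | cons l ls ih =>
    cases b <;> obtain ⟨Q, hQ, h⟩ := h <;>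
      exact ⟨fun u x y => Q u (α x) (β y), fun u => ih (hQ u), fun x y => h _ _⟩

/-- The bit is existentially guessed and then verified by both players. -/
theorem eq_signs (s : X → ℤˣ) (t : Y → ℤˣ) : Alt true [1] fun x y => s x = t y := by
  refine ⟨fun u x y => s x = sgn (u 0) ∧ t y = sgn (u 0),
    fun u => ⟨fun x => s x = sgn (u 0), fun y => t y = sgn (u 0), fun x y => Iff.rfl⟩,
    fun x y => ⟨fun h => ⟨fun _ => decide (s x = 1), ?_⟩, fun ⟨u, hx, hy⟩ => hx.trans hy.symm⟩⟩
  dsimp only at h ⊢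
  rw [← h, and_self]
  rcases Int.units_eq_one_or (s x) with h | h <;> rw [h] <;> simp [sgn]

/-- Splitting the quantified string into its blocks merges the two predicates at the leaves into
predicates of the whole string. -/
theorem exists_altQuant {P : X → Y → Prop} {b : Bool} {ls : List ℕ} (h : Alt b ls P) :
    ∃ (φ : X → List Bool → Bool) (ψ : Y → List Bool → Bool), ∀ x y,
      P x y ↔ altQuant b ls fun u => φ x u = true ∧ ψ y u = true := by
  classical
  induction ls generalizing b P with
  | nil =>
    obtain ⟨a, b, h⟩ := h
    exact ⟨fun x _ => decide (a x), fun y _ => decide (b y), fun x y => by simp [altQuant, h]⟩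
  | cons l ls ih =>
    have hsplit {α : Type} (φ : Word l → α → List Bool → Bool) : ∃ φ' : α → List Bool → Bool,
        ∀ u x w, φ' x (List.ofFn u ++ w) = φ u x w := by
      refine ⟨fun x w => φ (fun i => (w.take l).getD i false) x (w.drop l), fun u x w => ?_⟩
      have h1 : (List.ofFn u ++ w).take l = List.ofFn u := by
        rw [List.take_append_of_le_length (by simp), List.take_of_length_le (by simp)]
      have h2 : (List.ofFn u ++ w).drop l = w := List.drop_left' (by simp)
      have h3 : (fun i : Fin l => (List.ofFn u).getD i false) = u := by
        ext i
        simp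
      dsimp only
      rw [h1, h2, h3]
    cases b <;> obtain ⟨Q, hQ, h⟩ := h <;> choose φ ψ hφψ using fun u => ih (hQ u) <;>
      obtain ⟨φ', hφ'⟩ := hsplit φ <;> obtain ⟨ψ', hψ'⟩ := hsplit ψ <;>
      exact ⟨φ', ψ', fun x y => by simp only [h, altQuant, hφ', hψ', hφψ]⟩

end Alt

/-- The lengths of the quantified strings when counting up to `2 ^ k` in front of `ls`. -/
def countBlocks (K : ℕ) : ℕ → List ℕ → List ℕ
  | 0, ls => ls
  | k + 1, ls => K :: 1 :: countBlocks K k ls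

theorem length_countBlocks (K k : ℕ) (ls : List ℕ) :
    (countBlocks K k ls).length = 2 * k + ls.length := by
  induction k with
  | zero => simp [countBlocks]
  | succ k ih =>
    simp only [countBlocks, List.length_cons, ih]
    ring

theorem sum_countBlocks (K k : ℕ) (ls : List ℕ) :
    (countBlocks K k ls).sum = k * (K + 1) + ls.sum := by
  induction k with
  | zero => simp [countBlocks]
  | succ k ih =>
    simp only [countBlocks, List.sum_cons, ih]
    ring

/-- At least `t` of `2 ^ (k + 1)` predicates hold if and only if there is a number `j` such that
at least `j` predicates of the first half hold, and at least `t - j` predicates of the second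
half. -/
theorem Alt.le_count {X Y : Type} {ls : List ℕ} {K k : ℕ} (hk : k ≤ K) {Q : ℕ → X → Y → Prop}
    [∀ i x y, Decidable (Q i x y)] (hQ : ∀ i, Alt true ls (Q i)) (t : ℕ) :
    Alt true (countBlocks K k ls) fun x y => t ≤ Nat.count (fun i => Q i x y) (2 ^ k) := by
  induction k generalizing Q t with
  | zero =>
    have h0 (x y) : Nat.count (fun i => Q i x y) (2 ^ 0) = if Q 0 x y then 1 else 0 := by
      change Nat.count _ (0 + 1) = _
      rw [Nat.count_succ, Nat.count_zero, zero_add]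
    simp only [h0]
    rcases t with _ | _ | t
    · exact (const _ _ True).congr (by simp)
    · refine (hQ 0).congr fun x y => ?_
      by_cases h : Q 0 x y <;> simp [h]
    · refine (const _ _ False).congr fun x y => ?_
      by_cases h : Q 0 x y <;> simp [h]
  | succ k ih =>
    let e : Word K ≃ Fin (2 ^ K) := Fintype.equivFinOfCardEq (card_word K)
    refine ⟨fun u x y => ∀ b : Word 1, if b 0 then
        (e u : ℕ) ≤ Nat.count (fun i => Q i x y) (2 ^ k) else
        t - e u ≤ Nat.count (fun i => Q (2 ^ k + i) x y) (2 ^ k),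
      fun u => ⟨fun b x y => if b 0 then
        (e u : ℕ) ≤ Nat.count (fun i => Q i x y) (2 ^ k) else
        t - e u ≤ Nat.count (fun i => Q (2 ^ k + i) x y) (2 ^ k), fun b => ?_, fun x y => Iff.rfl⟩,
      fun x y => ?_⟩
    · cases hb : b 0
      · exact (ih (by omega) (fun i => hQ (2 ^ k + i)) (t - e u)).congr fun x y => by simp [hb]
      · exact (ih (by omega) hQ (e u)).congr fun x y => by simp [hb]
    · dsimp only
      rw [pow_succ, mul_two, Nat.count_add]
      constructor
      · intro h
        have hlt : Nat.count (fun i => Q i x y) (2 ^ k) < 2 ^ K :=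
          (Nat.count_le _).trans_lt (Nat.pow_lt_pow_right one_lt_two hk)
        refine ⟨e.symm ⟨_, hlt⟩, fun b => ?_⟩
        rw [Equiv.apply_symm_apply]
        split_ifs
        · exact le_rfl
        · simp only
          omega
      · rintro ⟨u, h⟩
        have h1 := h fun _ => true
        have h2 := h fun _ => false
        simp only [if_true, Bool.false_eq_true, if_false] at h1 h2
        omega

theorem count_eq_sum_fin (p : ℕ → Prop) [DecidablePred p] (n : ℕ) :
    Nat.count p n = ∑ i : Fin n, if p i then 1 else 0 := by
  rw [Nat.count_eq_card_filter_range, Finset.card_filter, Finset.sum_range]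

/-- Positivity of a sum of rank-one sign matrices says that more than half of the summands are
positive. -/
theorem HasRep.alt_pos {X Y : Type} {F : X → Y → ℤ} {k : ℕ} (hF : HasRep F (2 ^ k)) :
    Alt true (countBlocks k k [1]) fun x y => 0 < F x y := by
  obtain ⟨l, hl, s, t, h⟩ := hF
  have hQ (i : ℕ) : Alt true [1] fun x y => ∃ hi : i < l, s ⟨i, hi⟩ x = t ⟨i, hi⟩ y := by
    by_cases hi : i < l
    · exact (Alt.eq_signs (s ⟨i, hi⟩) (t ⟨i, hi⟩)).congr fun x y => by simp [hi]
    · exact (Alt.const _ _ False).congr fun x y => by simp [hi]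
  refine (Alt.le_count le_rfl hQ (l / 2 + 1)).congr fun x y => ?_
  have h1 : F x y + l = 2 * (Nat.count (fun i => ∃ hi : i < l, s ⟨i, hi⟩ x = t ⟨i, hi⟩ y)
      (2 ^ k) : ℤ) := by
    have h2 : Nat.count (fun i => ∃ hi : i < l, s ⟨i, hi⟩ x = t ⟨i, hi⟩ y) (2 ^ k) =
        Nat.count (fun i => ∃ hi : i < l, s ⟨i, hi⟩ x = t ⟨i, hi⟩ y) l := by
      rw [Nat.count_eq_card_filter_range, Nat.count_eq_card_filter_range]
      congr 1
      ext i
      simp only [Finset.mem_filter, Finset.mem_range]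
      exact ⟨fun ⟨_, hi, h⟩ => ⟨hi, hi, h⟩, fun ⟨_, hi, h⟩ => ⟨hi.trans_le hl, hi, h⟩⟩
    have h3 : (l : ℤ) = ∑ _i : Fin l, 1 := by simp
    rw [h2, count_eq_sum_fin, h, h3, Nat.cast_sum, Finset.mul_sum, ← Finset.sum_add_distrib]
    refine Finset.sum_congr rfl fun i _ => ?_
    rcases Int.units_eq_one_or (s i x) with e | e <;>
      rcases Int.units_eq_one_or (t i y) with e' | e' <;> simp [e, e']
  omega

/-- The bounded-error condition is weakened to a majority condition on the random strings, which
is again a threshold. -/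
theorem BPop_PPcc_subset_PSPACEcc : BPop PPcc ⊆ PSPACEcc := by
  rintro L ⟨L', hL', q, hq, h⟩
  simp only [acceptFraction_iff] at h
  set m : ℕ → ℕ := fun n => ⌈q (Real.logb 2 n)⌉₊ with hm_def
  have hm : IsPolylog fun n => (m n : ℝ) := isPolylog_natCeil_of_polyBounded hq
  set c : ℕ → ℕ := fun n => ppComplexity (nSection L' (pairLen n (m n))) with hc_def
  have hc : IsPolylog fun n => (c n : ℝ) := isPolylog_ppComplexity_pairLen hL' hm
  let ls (n : ℕ) : List ℕ := countBlocks (m n) (m n) (countBlocks (2 * c n) (2 * c n) [1])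
  have hlen (n) : (ls n).length = 2 * m n + (2 * (2 * c n) + 1) := by
    simp [ls, length_countBlocks]
  have hodd (n) : ¬ Even (ls n).length := by
    rw [hlen, Nat.not_even_iff_odd]
    exact ⟨m n + 2 * c n, by ring⟩
  have hsum (n) : (ls n).sum = m n * (m n + 1) + (2 * c n * (2 * c n + 1) + 1) := by
    simp [ls, sum_countBlocks]
  have hc2 : IsPolylog fun n => 2 * (c n : ℝ) := (IsPolylog.const 2).mul hc (by simp) (by simp)
  have key (n : ℕ) : ∃ (φ ψ : Word n → List Bool → Bool), 1 ≤ n → ∀ x y : Word n,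
      (⟨n, x, y⟩ : WordPair) ∈ L ↔
        altQuant true (ls n) fun u => φ x u = true ∧ ψ y u = true := by
    obtain ⟨F, hF, hFf⟩ := exists_hasRep_ppComplexity (nSection L' (pairLen n (m n)))
    replace hF : HasRep F (2 ^ (2 * c n)) := by rwa [pow_mul]
    let e : Word (m n) ≃ Fin (2 ^ m n) := Fintype.equivFinOfCardEq (card_word (m n))
    let r (i : ℕ) : Word (m n) := if hi : i < 2 ^ m n then e.symm ⟨i, hi⟩ else fun _ => false
    have hQ (i : ℕ) := hF.alt_pos.comap (fun x : Word n => pair x (r i))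
      fun y : Word n => pair y (r i)
    obtain ⟨φ, ψ, hφψ⟩ := (Alt.le_count (le_refl (m n)) hQ (2 ^ m n / 2 + 1)).exists_altQuant
    refine ⟨φ, ψ, fun hn x y => ?_⟩
    rw [← hφψ, count_eq_sum_fin]
    have hcount : (∑ i : Fin (2 ^ m n), if 0 < F (pair x (r i)) (pair y (r i)) then 1 else 0) =
        (Finset.univ.filter fun s : Word (m n) =>
          nSection L' (pairLen n (m n)) (pair x s) (pair y s) = true).card := by
      rw [Finset.card_filter, ← e.sum_comp]
      refine Finset.sum_congr rfl fun s _ => ?_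
      simp [r, hFf]
    have hcard := card_filter_eq_add_card_filter_ne fun s : Word (m n) =>
      nSection L' (pairLen n (m n)) (pair x s) (pair y s)
    have hne : 3 * (Finset.univ.filter fun s : Word (m n) => nSection L' (pairLen n (m n))
        (pair x s) (pair y s) ≠ nSection L n x y).card ≤ 2 ^ m n := h n hn x y
    have hpos : 0 < 2 ^ m n := by positivity
    rw [hcount, ← nSection_eq_true]
    cases hb : nSection L n x y
    · simp only [hb, ne_eq, Bool.not_eq_false] at hne
      simp only [Bool.false_eq_true, false_iff]
      omega
    · simp only [hb] at hne
      simp only [true_iff]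
      omega
  choose φ ψ hφψ using key
  refine ⟨ls, ?_, ?_, φ, ψ, fun n hn x y => ?_⟩
  · simp only [hlen]
    push_cast
    exact ((IsPolylog.const 2).mul hm (by simp) (by simp)).add
      (((IsPolylog.const 2).mul hc2 (by simp) (by simp)).add (.const 1))
  · simp only [hsum]
    push_cast
    exact (hm.mul (hm.add (.const 1)) (by simp) (fun n _ => by positivity)).add
      ((hc2.mul (hc2.add (.const 1)) (by simp) (fun n _ => by positivity)).add (.const 1))
  · rw [hφψ n hn]
    simp only [hodd, false_and, false_or, not_false_eq_true, true_and]

end CommCC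

theorem mainTheorem2 :
    CommCC.Mcc = CommCC.BPop CommCC.PPcc ∧
    CommCC.BPop CommCC.PPcc ⊆ CommCC.PSPACEcc ∧
    ¬ (CommCC.PSPACEcc ⊂ CommCC.Mcc) :=
  ⟨CommCC.Mcc_subset.antisymm CommCC.BPop_PPcc_subset_Mcc, CommCC.BPop_PPcc_subset_PSPACEcc,
    fun h => h.2 (CommCC.Mcc_subset.trans CommCC.BPop_PPcc_subset_PSPACEcc)⟩
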